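/- Let $d\ge 2$, $\mathbf n=\mathbf e_1+\dots+\mathbf e_{d+1}$, and let $X^d=\mathbb Z^{d+1}/\mathbb Z\mathbf n$, made into a graph by joining $[\mathbf x]$ to $[\mathbf x\pm\mathbf e_i]$, $1\le i\le d+1$. Identify $[\mathbf x]\in X^d$ with the orthogonal projection of $\mathbf x$ to the hyperplane $H=\mathbf n^\perp\subset\mathbb R^{d+1}$, and let $\mathbf g_i\in H$ be the projection of $\mathbf e_i$. Let $\mathcal S=\{s\in H^*: s(\mathbf g_i)\le 1\text{ for all }i\}$, and for $n\ge1$ let $\mathcal S_n=\{s\in\mathcal S: s(\mathbf g_i)\in\frac1n\mathbb Z\text{ for all }i\}$ and $L_n=n(d+1)X^d$. Let $\Omega$ be the set of height functions, that is, of functions $f:X^d\to\mathbb Z$ with $f(\mathbf 0)\in(d+1)\mathbb Z$ and $f(\mathbf x+\mathbf g_i)-f(\mathbf x)\in\{-d,1\}$ for all $\mathbf x\in X^d$ and all $i$. Let $\mathcal F^\nabla$ be the $\sigma$-algebra on $\Omega$ generated by the maps $f\mapsto f(\mathbf x)-f(\mathbf y)$, and for $R\subset X^d$ let $\mathcal F_R$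 be the $\sigma$-algebra generated by the maps $f\mapsto f(\mathbf x)$, $\mathbf x\in R$. Let $\mu$ be a probability measure on $(\Omega,\mathcal F^\nabla)$. - $\mu$ is *shift-invariant* if $\mu(\tilde\theta_{\mathbf v}A)=\mu(A)$ for all $\mathbf v\in X^d$ and $A\in\mathcal F^\nabla$, where $\tilde\theta_{\mathbf v}f=f(\cdot+\mathbf v)-f(\mathbf v)+f(\mathbf 0)$. - A shift-invariant $\mu$ has *slope* $s\in H^*$ if $\mathbb E_\mu[f(\mathbf x)-f(\mathbf 0)]=s(\mathbf x)$ for all $\mathbf x\in X^d$. - $\mu$ is a *gradient Gibbs measure* if for every finite $R\subset X^d$ and $A\in\mathcal F^\nabla$ we have $\mu(A)=\int\gamma_R(A,f)\,d\mu(f)$, where $\gamma_R(\cdot,f)$ is the uniform probability measure on the finite set of height functions that agree with $f$ outside $R$. Theorem. For every $s\in\mathcal S$ there is a shift-invariant gradient Gibbs measure $\mu$ on $(\Omega,\mathcal F^\nabla)$ of slope $s$ such that, for all $\mathbf x,\mathbf y\in X^d$ with graph distance $n$, 1. $\operatorname{Var}_\mu(f(\mathbf y)-f(\mathbf x))\le(d+1)^2n$;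 2. $\mu\big(f(\mathbf y)-f(\mathbf x)-s(\mathbf y-\mathbf x)\ge(d+1)a\big)\le\exp\big(-\frac{a^2}{2n}\big)$ for all real $a\ge0$, whenever $n>0$; 3. $\mu\big(f(\mathbf y)-f(\mathbf x)-s(\mathbf y-\mathbf x)\le(d+1)a\big)\le\exp\big(-\frac{a^2}{2n}\big)$ for all real $a\le0$, whenever $n>0$. Moreover, $\mu$ can be chosen to be a local limit of uniform measures on periodic height functions: there are slopes $s_n\in\mathcal S_n$ ($n\ge1$) with $s_n\to s$ and positive integers $k_1<k_2<\cdots$ such that, with $\mu_n$ the uniform probability measure on the finite set of height functions $f$ that satisfy $f(\mathbf 0)=0$ and $f(\mathbf x+\mathbf y)=f(\mathbf x)+s_n(\mathbf y)$ for all $\mathbf x\in X^d$, $\mathbf y\in L_n$, we have $\mu_{k_j}(A)\to\mu(A)$ as $j\to\infty$ for every finite $R\subset X^d$ and every $A\in\mathcal F^\nabla\cap\mathcal F_R$. -/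

import Mathlib

open MeasureTheory Filter Topology
open scoped ENNReal

noncomputable section

namespace SimplicialLattice

/-- The vertex set `X^d = ℤ^{d+1} / ℤ n` of the simplicial lattice, where `n = (1, …, 1)`. -/
abbrev X (d : ℕ) : Type :=
  (Fin (d + 1) → ℤ) ⧸ AddSubgroup.zmultiples (fun _ : Fin (d + 1) => (1 : ℤ))

/-- The class `[e_i]` of the `i`-th unit vector. -/
def g {d : ℕ} (i : Fin (d + 1)) : X d :=
  QuotientAddGroup.mk (Pi.single i (1 : ℤ))

/-- The graph `(X^d, E^d)`: the neighbours of `x` are the vertices `x ± [e_i]`. -/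
def graph (d : ℕ) : SimpleGraph (X d) :=
  SimpleGraph.fromRel (fun x y => ∃ i, y = x + g i)

/-- The hyperplane `H ⊆ ℝ^{d+1}` orthogonal to `n`. -/
def H (d : ℕ) : Submodule ℝ (Fin (d + 1) → ℝ) where
  carrier := {v | ∑ i, v i = 0}
  zero_mem' := by simp
  add_mem' := by
    intro a b ha hb
    simp only [Set.mem_ofPred_eq] at ha hb ⊢
    simp [Finset.sum_add_distrib, ha, hb]
  smul_mem' := by
    intro c a ha
    simp only [Set.mem_ofPred_eq] at ha ⊢
    simp [← Finset.mul_sum, ha]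

/-- The orthogonal projection `x ↦ x - ((x, n) / (d + 1)) n` of an integer vector to `H`. -/
def projInt (d : ℕ) : (Fin (d + 1) → ℤ) →+ H d where
  toFun x := ⟨fun i => (x i : ℝ) - (∑ j, (x j : ℝ)) / (d + 1), by
    have h : ((d : ℝ) + 1) ≠ 0 := by positivity
    change ∑ i, ((x i : ℝ) - (∑ j, (x j : ℝ)) / (d + 1)) = 0
    rw [Finset.sum_sub_distrib]
    simp
    field_simp
    ring⟩
  map_zero' := by ext i; simp
  map_add' x y := by
    ext i
    simp [Finset.sum_add_distrib]
    ring

/-- The embedding `X^d → H`, `[x] ↦ P x`, identifying `X^d` with a lattice in `H`. -/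
def embed (d : ℕ) : X d →+ H d :=
  QuotientAddGroup.lift _ (projInt d) (by
    intro x hx
    obtain ⟨k, rfl⟩ := AddSubgroup.mem_zmultiples_iff.mp hx
    have h : ((d : ℝ) + 1) ≠ 0 := by positivity
    ext i
    simp [projInt]
    field_simp
    ring)

/-- The set `𝒮` of Lipschitz slopes. -/
def slopes (d : ℕ) : Set (Module.Dual ℝ (H d)) :=
  {s | ∀ i, s (embed d (g i)) ≤ 1}

/-- The set `𝒮_n` of Lipschitz slopes with `s(g_i) ∈ ℤ / n` for all `i`; used for `n ≥ 1`. -/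
def slopesN (d n : ℕ) : Set (Module.Dual ℝ (H d)) :=
  {s | s ∈ slopes d ∧ ∀ i, ∃ k : ℤ, s (embed d (g i)) = (k : ℝ) / n}

/-- Height functions: the elements of the sample space `Ω`. -/
structure HeightFunction (d : ℕ) where
  toFun : X d → ℤ
  zero_dvd : ((d : ℤ) + 1) ∣ toFun 0
  grad_mem : ∀ x i, toFun (x + g i) - toFun x = -(d : ℤ) ∨ toFun (x + g i) - toFun x = 1

instance (d : ℕ) : CoeFun (HeightFunction d) (fun _ => X d → ℤ) :=
  ⟨HeightFunction.toFun⟩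

/-- The gradient σ-algebra `ℱ^∇`, generated by all `f ↦ f(x) - f(y)`. It is the σ-algebra that
`Ω` carries by default, so that `Measure (HeightFunction d)` is the type of measures on
`(Ω, ℱ^∇)`. -/
instance gradientField (d : ℕ) : MeasurableSpace (HeightFunction d) :=
  ⨆ (x : X d) (y : X d), MeasurableSpace.comap (fun f : HeightFunction d => f x - f y) ⊤

/-- The σ-algebra `ℱ_R` generated by the values `f(x)`, `x ∈ R`. -/
@[reducible] def fieldOn {d : ℕ} (R : Set (X d)) : MeasurableSpace (HeightFunction d) :=
  ⨆ x ∈ R, MeasurableSpace.comap (fun f : HeightFunction d => f x) ⊤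

/-- The shift `θ̃_v f = f(· + v) - f(v) + f(0)`. -/
def shift {d : ℕ} (v : X d) (f : HeightFunction d) : HeightFunction d where
  toFun x := f (x + v) - f v + f 0
  zero_dvd := by simpa using f.zero_dvd
  grad_mem x i := by
    have h := f.grad_mem (x + v) i
    rw [add_right_comm x (g i) v]
    rcases h with h | h
    · left; linarith
    · right; linarith

/-- Shift-invariance: `μ(θ̃ A) = μ(A)` for all shifts and all `A ∈ ℱ^∇`. -/
def IsShiftInvariant {d : ℕ} (μ : Measure (HeightFunction d)) : Prop :=
  ∀ (v : X d) (A : Set (HeightFunction d)), MeasurableSet A → μ (shift v '' A) = μ A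

/-- `μ` has slope `s`: `s(x) = 𝔼_μ[f(x) - f(0)]` for all `x`. -/
def HasSlope {d : ℕ} (μ : Measure (HeightFunction d)) (s : Module.Dual ℝ (H d)) : Prop :=
  ∀ x : X d, ∫ f, ((f x : ℝ) - (f 0 : ℝ)) ∂μ = s (embed d x)

/-- The uniform probability measure on a finite non-empty set `S` of height functions,
as a measure on `(Ω, ℱ^∇)`. -/
def uniformMeasure {d : ℕ} (S : Set (HeightFunction d)) : Measure (HeightFunction d) :=
  (S.encard : ℝ≥0∞)⁻¹ • Measure.sum (fun h : S => Measure.dirac (h : HeightFunction d))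

/-- Fixed boundary conditions: `Ω(R, f)` is the set of height functions equal to `f` off `R`. -/
def fixedBC {d : ℕ} (R : Set (X d)) (f : HeightFunction d) : Set (HeightFunction d) :=
  {h | ∀ x, x ∉ R → h x = f x}

/-- Gradient Gibbs measures: the DLR equation `μ = μ γ_R^∇` holds on `ℱ^∇` for all finite `R`,
where `γ_R^∇(·, f)` is the uniform distribution on `Ω(R, f)`. -/
def IsGradientGibbs {d : ℕ} (μ : Measure (HeightFunction d)) : Prop :=
  ∀ R : Set (X d), R.Finite → ∀ A : Set (HeightFunction d), MeasurableSet A →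
    μ A = ∫⁻ f, uniformMeasure (fixedBC R f) A ∂μ

/-- Periodic boundary conditions: `Ω(L, s)` is the set of height functions `f` with `f(0) = 0`
and `f(x + y) = f(x) + s(y)` for `x ∈ X^d`, `y ∈ L`. -/
def periodicBC {d : ℕ} (L : AddSubgroup (X d)) (s : Module.Dual ℝ (H d)) :
    Set (HeightFunction d) :=
  {f | f 0 = 0 ∧ ∀ x, ∀ y ∈ L, (f (x + y) : ℝ) = f x + s (embed d y)}

/-- The lattice `L_n = n (d + 1) X^d`. -/
def latticeN (d n : ℕ) : AddSubgroup (X d) :=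
  (nsmulAddMonoidHom (α := X d) (n * (d + 1))).range

/-- Convergence of gradient measures in the topology of local convergence: convergence of the
probability of every event in `ℱ^∇ ∩ ℱ_R`, for every finite `R`. -/
def LocallyConverges {d : ℕ} (ν : ℕ → Measure (HeightFunction d))
    (μ : Measure (HeightFunction d)) : Prop :=
  ∀ R : Set (X d), R.Finite → ∀ A : Set (HeightFunction d),
    MeasurableSet A → MeasurableSet[fieldOn R] A →
      Tendsto (fun k => ν k A) atTop (𝓝 (μ A))

end SimplicialLattice

end

open SimplicialLattice

/-!
Let `L` be a lattice of finite index and let `W` be the set of height functions `f` with `f 0 = 0`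
that are periodic with slope `s` along `L`. This `W` is closed under pointwise minimum and maximum,
so by Holley's argument (the four functions theorem) the mean of `f w` is monotone in a prescribed
value `f v`. Comparing `f` with `h + (d + 1)` in the same way shows that increasing `f v` by `d + 1`
increases this mean by at most `d + 1`. The value at a neighbour of `0` takes at most two values,
which differ by `d + 1`; hence revealing the heights along a shortest walk from `0` to `w` changes
the conditional mean of `f w` by at most `d + 1` at each step, and Hoeffding's lemma makes
`f w - s w` sub-Gaussian with variance proxy `(d + 1) ^ 2` times the distance. Its mean is `0`
because by shift invariance the mean of `f w` is additive in `w`, and it equals `s w` on `L`.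

The largest height function below a slope in `slopesN d n` shows that `W` is nonempty for the
lattice `L_n`. Gradients form a compact space, so some subsequence of the uniform measures converges
locally, and moment bounds and mean increments pass to the limit. For the Gibbs property, note that
once the nonzero elements of `L` are long, a change of `f` on a finite set `R` can be repeated on
the translates of `R` by `L`; so the uniform measure on `W`, conditioned on the gradient off these
translates, is on `R` exactly the uniform measure with boundary condition `f`.
-/

noncomputable section

namespace SimplicialLattice

section LatticeAverages

open scoped BigOperators FinsetFamily

variable {β : Type*} [DistribLattice β] {U V : Finset β} {φ : β → ℝ}

theorem sum_mul_card_le_card_mul_sum_of_nonneg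
    (hUV : ∀ u ∈ U, ∀ v ∈ V, u ⊓ v ∈ U ∧ u ⊔ v ∈ V) (hφ : Monotone φ)
    (hU : ∀ u ∈ U, 0 ≤ φ u) (hV : ∀ v ∈ V, 0 ≤ φ v) :
    (∑ u ∈ U, φ u) * V.card ≤ U.card * ∑ v ∈ V, φ v := by
  classical
  set onU : (β → ℝ) → β → ℝ := fun ψ => (U : Set β).indicator ψ
  set onV : (β → ℝ) → β → ℝ := fun ψ => (V : Set β).indicator ψ
  have onU_nonneg {ψ : β → ℝ} (hψ : ∀ u ∈ U, 0 ≤ ψ u) : 0 ≤ onU ψ := Set.indicator_nonneg hψ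
  have onV_nonneg {ψ : β → ℝ} (hψ : ∀ v ∈ V, 0 ≤ ψ v) : 0 ≤ onV ψ := Set.indicator_nonneg hψ
  have one_nonneg (W : Finset β) : ∀ w ∈ W, 0 ≤ (1 : β → ℝ) w := fun _ _ => zero_le_one
  have pointwise (a b : β) : onU φ a * onV 1 b ≤ onU 1 (a ⊓ b) * onV φ (a ⊔ b) := by
    by_cases hab : a ∈ U ∧ b ∈ V
    · obtain ⟨hinf, hsup⟩ := hUV a hab.1 b hab.2
      simpa [onU, onV, hab, hinf, hsup] using hφ le_sup_left
    · refine le_trans (le_of_eq ?_) (mul_nonneg (onU_nonneg (one_nonneg U) _) (onV_nonneg hV _))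
      rcases not_and_or.mp hab with ha | hb
      · simp [onU, ha]
      · simp [onV, hb]
  have sum_indicator (T W : Finset β) (ψ : β → ℝ) (hψ : ∀ w ∈ W, 0 ≤ ψ w) :
      ∑ a ∈ T, (W : Set β).indicator ψ a ≤ ∑ w ∈ W, ψ w := by
    simp only [Set.indicator_apply, Finset.mem_coe, ← Finset.sum_filter, Finset.filter_mem_eq_inter]
    exact Finset.sum_le_sum_of_subset_of_nonneg Finset.inter_subset_right fun w hw _ => hψ w hw
  calc (∑ u ∈ U, φ u) * V.card = (∑ a ∈ U, onU φ a) * ∑ b ∈ V, onV 1 b := by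
        simp +contextual [onU, onV]
    _ ≤ (∑ a ∈ U ⊼ V, onU 1 a) * ∑ b ∈ U ⊻ V, onV φ b :=
        four_functions_theorem _ _ _ _ (onU_nonneg hU) (onV_nonneg (one_nonneg V))
          (onU_nonneg (one_nonneg U)) (onV_nonneg hV) pointwise U V
    _ ≤ (∑ u ∈ U, 1) * ∑ v ∈ V, φ v :=
        mul_le_mul (sum_indicator _ U 1 (one_nonneg U)) (sum_indicator _ V φ hV)
          (Finset.sum_nonneg fun b _ => onV_nonneg hV b) (Finset.sum_nonneg (one_nonneg U))
    _ = U.card * ∑ v ∈ V, φ v := by simp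

theorem expect_le_expect_of_inf_mem_of_sup_mem (hU : U.Nonempty) (hV : V.Nonempty)
    (hUV : ∀ u ∈ U, ∀ v ∈ V, u ⊓ v ∈ U ∧ u ⊔ v ∈ V) (hφ : Monotone φ) :
    𝔼 u ∈ U, φ u ≤ 𝔼 v ∈ V, φ v := by
  classical
  obtain ⟨c, hc⟩ := ((U ∪ V).finite_toSet.image φ).bddBelow
  have shifted_nonneg : ∀ w ∈ U ∪ V, 0 ≤ φ w - c := fun w hw =>
    sub_nonneg.mpr (hc (Set.mem_image_of_mem φ hw))
  have key := sum_mul_card_le_card_mul_sum_of_nonneg hUV (hφ.add_const (-c))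
    (fun u hu => shifted_nonneg u (Finset.mem_union_left V hu))
    (fun v hv => shifted_nonneg v (Finset.mem_union_right U hv))
  rw [Finset.expect_eq_sum_div_card, Finset.expect_eq_sum_div_card,
    div_le_div_iff₀ (by exact_mod_cast hU.card_pos) (by exact_mod_cast hV.card_pos)]
  simp only [Finset.sum_add_distrib, Finset.sum_const, nsmul_eq_mul] at key
  linarith

end LatticeAverages

section CenteredMGF

open scoped BigOperators

variable {ι : Type*}

/-- The moment generating function at `l` of `φ` minus its mean, for the uniform distribution on
the finite set `s`. It is `0` for `s = ∅`. -/
def centeredMGF (s : Finset ι) (φ : ι → ℝ) (l : ℝ) : ℝ :=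
  𝔼 i ∈ s, Real.exp (l * (φ i - 𝔼 j ∈ s, φ j))

theorem sum_exp_mul_sub (s : Finset ι) (φ : ι → ℝ) (l m : ℝ) :
    ∑ i ∈ s, Real.exp (l * (φ i - m)) =
      s.card * Real.exp (l * ((𝔼 i ∈ s, φ i) - m)) * centeredMGF s φ l := by
  rw [mul_right_comm, centeredMGF, Finset.card_mul_expect, Finset.sum_mul]
  refine Finset.sum_congr rfl fun i _ => ?_
  rw [← Real.exp_add]
  ring_nf

theorem centeredMGF_le_one_of_const {s : Finset ι} {φ : ι → ℝ} {c : ℝ} (hφ : ∀ i ∈ s, φ i = c)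
    (l : ℝ) : centeredMGF s φ l ≤ 1 := by
  rcases s.eq_empty_or_nonempty with rfl | hs
  · simp [centeredMGF]
  · refine Finset.expect_le hs fun i hi => ?_
    rw [Finset.expect_congr rfl hφ, Finset.expect_const hs, hφ i hi, sub_self, mul_zero,
      Real.exp_zero]

theorem exp_mul_le_cosh_add_mul_sinh_of_abs_le {D u : ℝ} (hu : |u| ≤ D) (l : ℝ) :
    Real.exp (l * u) ≤ Real.cosh (l * D) + u * (Real.sinh (l * D) / D) := by
  rcases ((abs_nonneg u).trans hu).eq_or_lt with rfl | hD
  · simp [abs_nonpos_iff.mp hu]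
  · have hle : |u / D| ≤ 1 := by rwa [abs_div, abs_of_pos hD, div_le_one hD]
    have h := Real.exp_mul_le_cosh_add_mul_sinh hle (l * D)
    rwa [show u / D * (l * D) = l * u by field_simp, div_mul_eq_mul_div, ← mul_div_assoc'] at h

theorem add_mul_exp_le_of_centered {a b x y D : ℝ} (ha : 0 ≤ a) (hb : 0 ≤ b) (hx : |x| ≤ D)
    (hy : |y| ≤ D) (hxy : a * x + b * y = 0) (l : ℝ) :
    a * Real.exp (l * x) + b * Real.exp (l * y) ≤ (a + b) * Real.exp (l ^ 2 * D ^ 2 / 2) :=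
  calc a * Real.exp (l * x) + b * Real.exp (l * y)
      ≤ a * (Real.cosh (l * D) + x * (Real.sinh (l * D) / D)) +
          b * (Real.cosh (l * D) + y * (Real.sinh (l * D) / D)) := by
        gcongr <;> exact exp_mul_le_cosh_add_mul_sinh_of_abs_le (by assumption) l
    _ = (a + b) * Real.cosh (l * D) + (a * x + b * y) * (Real.sinh (l * D) / D) := by ring
    _ ≤ (a + b) * Real.exp (l ^ 2 * D ^ 2 / 2) := by
        rw [hxy, zero_mul, add_zero, ← mul_pow]
        gcongr
        exact Real.cosh_le_exp_half_sq _

theorem abs_sub_weighted_mean_le {a b x y m D : ℝ} (ha : 0 < a) (hb : 0 < b)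
    (hm : (a + b) * m = a * x + b * y) (hD : |x - y| ≤ D) : |x - m| ≤ D := by
  have hxm : x - m = b / (a + b) * (x - y) := by
    field_simp
    linarith
  have hweight : |b / (a + b)| ≤ 1 := by
    rw [abs_of_pos (by positivity), div_le_one (by positivity)]
    linarith
  rw [hxm, abs_mul]
  exact (mul_le_of_le_one_left (abs_nonneg _) hweight).trans hD

theorem card_add_card_mul_expect_disjUnion {s t : Finset ι} (hst : Disjoint s t) (φ : ι → ℝ) :
    (s.card + t.card : ℝ) * 𝔼 i ∈ s.disjUnion t hst, φ i =
      s.card * (𝔼 i ∈ s, φ i) + t.card * 𝔼 i ∈ t, φ i := by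
  rw [← Nat.cast_add, ← Finset.card_disjUnion s t hst, Finset.card_mul_expect,
    Finset.card_mul_expect, Finset.card_mul_expect, Finset.sum_disjUnion]

theorem centeredMGF_disjUnion_le {s t : Finset ι} (hst : Disjoint s t) {φ : ι → ℝ} {D E l : ℝ}
    (hD : s.Nonempty → t.Nonempty → |(𝔼 i ∈ s, φ i) - 𝔼 i ∈ t, φ i| ≤ D)
    (hs : centeredMGF s φ l ≤ E) (ht : centeredMGF t φ l ≤ E) :
    centeredMGF (s.disjUnion t hst) φ l ≤ Real.exp (l ^ 2 * D ^ 2 / 2) * E := by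
  have hE : 0 ≤ E := (Finset.expect_nonneg fun i _ => (Real.exp_pos _).le).trans hs
  have hEexp : E ≤ Real.exp (l ^ 2 * D ^ 2 / 2) * E :=
    le_mul_of_one_le_left hE (Real.one_le_exp (by positivity))
  rcases s.eq_empty_or_nonempty with rfl | hs₀
  · simpa using ht.trans hEexp
  rcases t.eq_empty_or_nonempty with rfl | ht₀
  · simpa using hs.trans hEexp
  have hmean := card_add_card_mul_expect_disjUnion hst φ
  set a : ℝ := (s.card : ℝ)
  set b : ℝ := (t.card : ℝ)
  set m := 𝔼 i ∈ s.disjUnion t hst, φ i with hm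
  set x := 𝔼 i ∈ s, φ i
  set y := 𝔼 i ∈ t, φ i
  have ha : 0 < a := Nat.cast_pos.mpr hs₀.card_pos
  have hb : 0 < b := Nat.cast_pos.mpr ht₀.card_pos
  have hxy : |x - y| ≤ D := hD hs₀ ht₀
  have hxm : |x - m| ≤ D := abs_sub_weighted_mean_le ha hb hmean hxy
  have hym : |y - m| ≤ D :=
    abs_sub_weighted_mean_le hb ha (by linarith) (abs_sub_comm x y ▸ hxy)
  refine le_of_mul_le_mul_left ?_ (add_pos ha hb)
  calc (a + b) * centeredMGF (s.disjUnion t hst) φ l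
      = ∑ i ∈ s.disjUnion t hst, Real.exp (l * (φ i - m)) := by
        rw [sum_exp_mul_sub, ← hm, sub_self, mul_zero, Real.exp_zero, mul_one,
          Finset.card_disjUnion, Nat.cast_add]
    _ = a * Real.exp (l * (x - m)) * centeredMGF s φ l +
          b * Real.exp (l * (y - m)) * centeredMGF t φ l := by
        rw [Finset.sum_disjUnion, sum_exp_mul_sub, sum_exp_mul_sub]
    _ ≤ a * Real.exp (l * (x - m)) * E + b * Real.exp (l * (y - m)) * E := by gcongr
    _ = (a * Real.exp (l * (x - m)) + b * Real.exp (l * (y - m))) * E := by ring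
    _ ≤ (a + b) * Real.exp (l ^ 2 * D ^ 2 / 2) * E := by
        gcongr
        exact add_mul_exp_le_of_centered ha.le hb.le hxm hym (by linarith) l
    _ = (a + b) * (Real.exp (l ^ 2 * D ^ 2 / 2) * E) := mul_assoc _ _ _

end CenteredMGF

section TranslationLattice

open scoped BigOperators

variable {α : Type*} {D : ℤ}

/-- A set `W` of integer-valued functions that is a lattice and satisfies `f ⊓ (h + D) ∈ W` and
`f ⊔ (h + D) ∈ W + D` for `f, h ∈ W`; the latter condition is translated by `-D`. These are the
closure properties used to compare averages over `W` with averages over `W + D`. -/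
structure IsTranslationLattice (D : ℤ) (W : Set (α → ℤ)) : Prop where
  inf_mem : ∀ f ∈ W, ∀ h ∈ W, f ⊓ h ∈ W
  sup_mem : ∀ f ∈ W, ∀ h ∈ W, f ⊔ h ∈ W
  inf_add_mem : ∀ f ∈ W, ∀ h ∈ W, (f ⊓ fun x => h x + D) ∈ W
  sub_sup_mem : ∀ f ∈ W, ∀ h ∈ W, ((fun x => f x - D) ⊔ h) ∈ W

namespace IsTranslationLattice

theorem filter_eq (hD : 0 ≤ D) {W : Finset (α → ℤ)} (hW : IsTranslationLattice D (W : Set (α → ℤ)))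
    (v : α) (b : ℤ) :
    IsTranslationLattice D ((W.filter fun f => f v = b : Finset (α → ℤ)) : Set (α → ℤ)) := by
  simp only [Finset.coe_filter]
  constructor <;> rintro f ⟨hfW, hf⟩ h ⟨hhW, hh⟩
  · exact ⟨hW.inf_mem f hfW h hhW, by simp [hf, hh]⟩
  · exact ⟨hW.sup_mem f hfW h hhW, by simp [hf, hh]⟩
  · exact ⟨hW.inf_add_mem f hfW h hhW, by simp [hf, hh, hD]⟩
  · exact ⟨hW.sub_sup_mem f hfW h hhW, by simp [hf, hh, hD]⟩

variable {W : Finset (α → ℤ)} {v : α} {b : ℤ}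

theorem expect_filter_le_expect_filter_add (hD : 0 ≤ D)
    (hW : IsTranslationLattice D (W : Set (α → ℤ))) (h₀ : (W.filter fun f => f v = b).Nonempty)
    (h₁ : (W.filter fun f => f v = b + D).Nonempty) (w : α) :
    𝔼 f ∈ W.filter (fun f => f v = b), (f w : ℝ) ≤
      𝔼 f ∈ W.filter (fun f => f v = b + D), (f w : ℝ) := by
  refine expect_le_expect_of_inf_mem_of_sup_mem h₀ h₁ (fun f hf h hh => ?_)
    fun f h hfh => Int.cast_le.mpr (Pi.le_def.mp hfh w)
  simp only [Finset.mem_filter] at hf hh ⊢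
  exact ⟨⟨hW.inf_mem f hf.1 h hh.1, by simp [hf.2, hh.2, hD]⟩,
    ⟨hW.sup_mem f hf.1 h hh.1, by simp [hf.2, hh.2, hD]⟩⟩

theorem expect_filter_add_le_expect_filter_add (hW : IsTranslationLattice D (W : Set (α → ℤ)))
    (h₀ : (W.filter fun f => f v = b).Nonempty)
    (h₁ : (W.filter fun f => f v = b + D).Nonempty) (w : α) :
    𝔼 f ∈ W.filter (fun f => f v = b + D), (f w : ℝ) ≤
      (𝔼 f ∈ W.filter (fun f => f v = b), (f w : ℝ)) + D := by
  classical
  set translate : (α → ℤ) → α → ℤ := fun h x => h x + D with htranslate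
  have translate_injective : Function.Injective translate :=
    fun f h hfh => funext fun x => add_right_cancel (congrFun hfh x)
  calc 𝔼 f ∈ W.filter (fun f => f v = b + D), (f w : ℝ)
      ≤ 𝔼 f ∈ (W.filter fun f => f v = b).image translate, (f w : ℝ) := by
        refine expect_le_expect_of_inf_mem_of_sup_mem h₁ (h₀.image translate) ?_
          fun f h hfh => Int.cast_le.mpr (Pi.le_def.mp hfh w)
        intro f hf h' hh'
        obtain ⟨h, hh, rfl⟩ := Finset.mem_image.mp hh'
        simp only [Finset.mem_filter] at hf hh
        have hsup : translate ((fun x => f x - D) ⊔ h) = f ⊔ translate h := by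
          ext x
          simp [translate, ← max_add_add_right]
        refine ⟨Finset.mem_filter.mpr
            ⟨hW.inf_add_mem f hf.1 h hh.1, by simp [hf.2, hh.2, translate]⟩,
          Finset.mem_image.mpr ⟨_, Finset.mem_filter.mpr ⟨hW.sub_sup_mem f hf.1 h hh.1, ?_⟩, hsup⟩⟩
        simp [hf.2, hh.2]
    _ = (𝔼 f ∈ W.filter (fun f => f v = b), (f w : ℝ)) + D := by
        rw [Finset.expect_image translate_injective.injOn]
        simp only [htranslate, Int.cast_add, Finset.expect_add_distrib, Finset.expect_const h₀]

theorem centeredMGF_le (hD : 0 < D) (l : ℝ) {G : SimpleGraph α} {u w : α} (p : G.Walk u w)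
    (hW : IsTranslationLattice D (W : Set (α → ℤ)))
    (hstep : ∀ a b, G.Adj a b → ∃ c, ∀ f ∈ W, f b - f a = c ∨ f b - f a = c + D)
    (hu : ∃ c, ∀ f ∈ W, f u = c) :
    centeredMGF W (fun f => (f w : ℝ)) l ≤ Real.exp (l ^ 2 * D ^ 2 / 2) ^ p.length := by
  classical
  induction p generalizing W with
  | nil =>
    obtain ⟨c, hc⟩ := hu
    simpa using centeredMGF_le_one_of_const (c := (c : ℝ)) (fun f hf => by simp [hc f hf]) l
  | @cons u v w huv p ih =>
    obtain ⟨c, hc⟩ := hu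
    obtain ⟨c', hc'⟩ := hstep u v huv
    have hv : ∀ f ∈ W, f v = c + c' ∨ f v = c + c' + D := fun f hf => by
      have := hc f hf
      have := hc' f hf
      omega
    have disjoint_fibres : Disjoint (W.filter fun f => f v = c + c')
        (W.filter fun f => f v = c + c' + D) :=
      Finset.disjoint_filter.mpr fun f _ h h' => by omega
    have disjUnion_fibres : W = (W.filter fun f => f v = c + c').disjUnion
        (W.filter fun f => f v = c + c' + D) disjoint_fibres := by
      rw [Finset.disjUnion_eq_union, ← Finset.filter_or, Finset.filter_true_of_mem hv]
    have fibre_le (b : ℤ) : centeredMGF (W.filter fun f => f v = b) (fun f => (f w : ℝ)) l ≤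
        Real.exp (l ^ 2 * D ^ 2 / 2) ^ p.length :=
      ih (hW.filter_eq hD.le v b)
        (fun a b hab => (hstep a b hab).imp fun _ h f hf => h f (Finset.mem_of_mem_filter f hf))
        ⟨b, fun f hf => (Finset.mem_filter.mp hf).2⟩
    rw [disjUnion_fibres, SimpleGraph.Walk.length_cons, pow_succ']
    refine centeredMGF_disjUnion_le _ (fun h₀ h₁ => ?_) (fibre_le _) (fibre_le _)
    rw [abs_sub_comm, abs_sub_le_iff]
    have hD' : (0 : ℝ) ≤ D := by exact_mod_cast hD.le
    exact ⟨by linarith [hW.expect_filter_add_le_expect_filter_add h₀ h₁ w],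
      by linarith [hW.expect_filter_le_expect_filter_add hD.le h₀ h₁ w]⟩

end IsTranslationLattice

end TranslationLattice

section Lattice

variable {d : ℕ}

theorem mk_const (k : ℤ) : (QuotientAddGroup.mk (fun _ => k) : X d) = 0 := by
  rw [QuotientAddGroup.eq_zero_iff, AddSubgroup.mem_zmultiples_iff]
  exact ⟨k, by funext i; simp⟩

theorem mk_eq_sum_zsmul_g (v : Fin (d + 1) → ℤ) :
    (QuotientAddGroup.mk v : X d) = ∑ i, v i • g i := by
  conv_lhs => rw [← Finset.univ_sum_single v, ← QuotientAddGroup.mk'_apply, map_sum]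
  refine Finset.sum_congr rfl fun i _ => ?_
  rw [g, ← QuotientAddGroup.mk'_apply, ← map_zsmul, ← Pi.single_smul, smul_eq_mul, mul_one]

theorem sum_g : ∑ i, (g i : X d) = 0 := by
  simpa only [one_smul, mk_const] using (mk_eq_sum_zsmul_g (d := d) fun _ => 1).symm

theorem closure_range_g : AddSubgroup.closure (Set.range (g : Fin (d + 1) → X d)) = ⊤ := by
  rw [eq_top_iff]
  rintro x -
  obtain ⟨v, rfl⟩ := QuotientAddGroup.mk_surjective x
  rw [mk_eq_sum_zsmul_g]
  exact AddSubgroup.sum_mem _ fun i _ =>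
    AddSubgroup.zsmul_mem _ (AddSubgroup.subset_closure (Set.mem_range_self i)) _

theorem lattice_induction {P : X d → Prop} (zero : P 0)
    (add_g_iff : ∀ x i, P (x + g i) ↔ P x) (x : X d) : P x := by
  have hx : x ∈ AddSubgroup.closure (Set.range (g : Fin (d + 1) → X d)) :=
    closure_range_g ▸ AddSubgroup.mem_top x
  induction hx using AddSubgroup.closure_induction_right with
  | zero => exact zero
  | add_right x _ y hy ih =>
    obtain ⟨i, rfl⟩ := hy
    exact (add_g_iff x i).mpr ih
  | add_neg_cancel x _ y hy ih =>
    obtain ⟨i, rfl⟩ := hy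
    rwa [← add_g_iff _ i, neg_add_cancel_right]

theorem graph_adj_iff {x y : X d} :
    (graph d).Adj x y ↔ x ≠ y ∧ ((∃ i, y = x + g i) ∨ ∃ i, x = y + g i) := by
  rw [graph, SimpleGraph.fromRel_adj]

theorem reachable_add_g (x : X d) (i : Fin (d + 1)) : (graph d).Reachable x (x + g i) := by
  by_cases h : x = x + g i
  · rw [← h]
  · exact SimpleGraph.Adj.reachable (graph_adj_iff.mpr ⟨h, Or.inl ⟨i, rfl⟩⟩)

theorem graph_preconnected : (graph d).Preconnected := by
  have reachable_zero : ∀ x : X d, (graph d).Reachable 0 x :=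
    lattice_induction (SimpleGraph.Reachable.refl _) fun x i =>
      ⟨fun h => h.trans (reachable_add_g x i).symm, fun h => h.trans (reachable_add_g x i)⟩
  exact fun x y => (reachable_zero x).symm.trans (reachable_zero y)

/-- The translation by `v`, as an endomorphism of the lattice graph. -/
def translateHom (v : X d) : graph d →g graph d where
  toFun x := x + v
  map_rel' := by
    intro a b hab
    rw [graph_adj_iff] at hab ⊢
    refine ⟨fun h => hab.1 (add_right_cancel h), ?_⟩
    rcases hab.2 with ⟨i, rfl⟩ | ⟨i, rfl⟩
    · exact Or.inl ⟨i, add_right_comm a (g i) v⟩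
    · exact Or.inr ⟨i, add_right_comm b (g i) v⟩

theorem exists_walk_zero_length_eq_dist (x y : X d) :
    ∃ p : (graph d).Walk 0 (y - x), p.length = (graph d).dist x y := by
  obtain ⟨p, hp⟩ := (graph_preconnected x y).exists_walk_length_eq_dist
  have hx : translateHom (-x) x = 0 := add_neg_cancel x
  have hy : translateHom (-x) y = y - x := (sub_eq_add_neg y x).symm
  refine ⟨(p.map (translateHom (-x))).copy hx hy, ?_⟩
  rw [SimpleGraph.Walk.length_copy, SimpleGraph.Walk.length_map, hp]

end Lattice

section Height

variable {d : ℕ}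

/-- The property that makes a function on the lattice a height function. It allows lattice
operations to be carried out on functions rather than on the structure `HeightFunction`. -/
def IsHeight (u : X d → ℤ) : Prop :=
  ((d : ℤ) + 1) ∣ u 0 ∧ ∀ x i, u (x + g i) - u x = -(d : ℤ) ∨ u (x + g i) - u x = 1

namespace IsHeight

variable {u v : X d → ℤ}

theorem dvd_sub (hu : IsHeight u) (hv : IsHeight v) (x : X d) : ((d : ℤ) + 1) ∣ u x - v x := by
  induction x using lattice_induction with
  | zero => exact _root_.dvd_sub hu.1 hv.1
  | add_g_iff x i =>
    have hstep : ((d : ℤ) + 1) ∣ (u (x + g i) - v (x + g i)) - (u x - v x) := by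
      rw [sub_sub_sub_comm]
      rcases hu.2 x i with h1 | h1 <;> rcases hv.2 x i with h2 | h2 <;> rw [h1, h2]
      · simp
      · exact ⟨-1, by ring⟩
      · exact ⟨1, by ring⟩
      · simp
    exact dvd_iff_dvd_of_dvd_sub hstep

theorem add_le_of_lt (hu : IsHeight u) (hv : IsHeight v) {x : X d} (h : u x < v x) :
    u x + (d + 1) ≤ v x := by
  have := Int.le_of_dvd (sub_pos.mpr h) (hv.dvd_sub hu x)
  linarith

theorem inf (hu : IsHeight u) (hv : IsHeight v) : IsHeight (u ⊓ v) := by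
  refine ⟨?_, fun x i => ?_⟩
  · rcases le_total (u 0) (v 0) with h | h <;> simp [h, hu.1, hv.1]
  · have := hu.2 x i
    have := hv.2 x i
    have := hu.add_le_of_lt hv (x := x)
    have := hv.add_le_of_lt hu (x := x)
    simp only [Pi.inf_apply]
    omega

theorem sup (hu : IsHeight u) (hv : IsHeight v) : IsHeight (u ⊔ v) := by
  refine ⟨?_, fun x i => ?_⟩
  · rcases le_total (u 0) (v 0) with h | h <;> simp [h, hu.1, hv.1]
  · have := hu.2 x i
    have := hv.2 x i
    have := hu.add_le_of_lt hv (x := x)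
    have := hv.add_le_of_lt hu (x := x)
    simp only [Pi.sup_apply]
    omega

theorem add_const (hu : IsHeight u) {c : ℤ} (hc : ((d : ℤ) + 1) ∣ c) :
    IsHeight fun x => u x + c :=
  ⟨dvd_add hu.1 hc, fun x i => by simpa using hu.2 x i⟩

end IsHeight

@[ext]
theorem HeightFunction.ext {f h : HeightFunction d} (hfh : ∀ x, f x = h x) : f = h := by
  cases f
  cases h
  congr 1
  exact funext hfh

theorem HeightFunction.isHeight (f : HeightFunction d) : IsHeight f.toFun :=
  ⟨f.zero_dvd, f.grad_mem⟩

theorem HeightFunction.sub_eq_or_of_adj {a b : X d} (h : (graph d).Adj a b) :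
    ∃ c : ℤ, ∀ f : HeightFunction d, f b - f a = c ∨ f b - f a = c + (d + 1) := by
  rcases (graph_adj_iff.mp h).2 with ⟨i, rfl⟩ | ⟨i, rfl⟩
  · refine ⟨-d, fun f => ?_⟩
    have := f.grad_mem a i
    omega
  · refine ⟨-1, fun f => ?_⟩
    have := f.grad_mem b i
    omega

theorem HeightFunction.exists_forall_abs_sub_le (x : X d) :
    ∃ B : ℤ, ∀ f : HeightFunction d, |f x - f 0| ≤ B := by
  induction x using lattice_induction with
  | zero => exact ⟨0, by simp⟩
  | add_g_iff x i =>
    have hstep : ∀ f : HeightFunction d, |f (x + g i) - f x| ≤ d + 1 := fun f => by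
      have := f.grad_mem x i
      rw [abs_le]
      omega
    refine ⟨fun ⟨B, hB⟩ => ⟨B + (d + 1), fun f => ?_⟩, fun ⟨B, hB⟩ => ⟨B + (d + 1), fun f => ?_⟩⟩
      <;> have := abs_le.mp (hB f) <;> have := abs_le.mp (hstep f) <;> rw [abs_le] <;> omega

theorem shift_shift_neg (v : X d) (f : HeightFunction d) : shift v (shift (-v) f) = f := by
  ext x
  simp [shift]

theorem shift_neg_shift (v : X d) (f : HeightFunction d) : shift (-v) (shift v f) = f := by
  simpa using shift_shift_neg (-v) f

theorem image_shift (v : X d) (A : Set (HeightFunction d)) : shift v '' A = shift (-v) ⁻¹' A :=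
  congrFun (Set.image_eq_preimage_of_inverse (shift_neg_shift v) (shift_shift_neg v)) A

theorem shift_injective (v : X d) : Function.Injective (shift v : HeightFunction d → _) :=
  Function.LeftInverse.injective (shift_neg_shift v)

end Height

section Periodic

variable {d : ℕ} {L : AddSubgroup (X d)} {s : Module.Dual ℝ (H d)}

/-- The periodicity condition `u(x + y) = u(x) + s(y)` for all `y ∈ L`, on functions that need not
be height functions nor vanish at the origin. -/
def IsPeriodicUpTo (L : AddSubgroup (X d)) (s : Module.Dual ℝ (H d)) (u : X d → ℤ) : Prop :=
  ∀ x, ∀ y ∈ L, (u (x + y) : ℝ) = u x + s (embed d y)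

namespace IsPeriodicUpTo

variable {u v : X d → ℤ}

theorem inf (hu : IsPeriodicUpTo L s u) (hv : IsPeriodicUpTo L s v) :
    IsPeriodicUpTo L s (u ⊓ v) := by
  intro x y hy
  simp only [Pi.inf_apply, Int.cast_min, hu x y hy, hv x y hy, min_add_add_right]

theorem sup (hu : IsPeriodicUpTo L s u) (hv : IsPeriodicUpTo L s v) :
    IsPeriodicUpTo L s (u ⊔ v) := by
  intro x y hy
  simp only [Pi.sup_apply, Int.cast_max, hu x y hy, hv x y hy, max_add_add_right]

theorem add_const (hu : IsPeriodicUpTo L s u) (c : ℤ) : IsPeriodicUpTo L s fun x => u x + c := by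
  intro x y hy
  push_cast
  rw [hu x y hy, add_right_comm]

end IsPeriodicUpTo

theorem shift_mem_periodicBC {f : HeightFunction d} (hf : f ∈ periodicBC L s) (v : X d) :
    shift v f ∈ periodicBC L s := by
  refine ⟨by simp [shift, hf.1], fun x y hy => ?_⟩
  simp only [shift, Int.cast_add, Int.cast_sub]
  rw [add_right_comm, hf.2 (x + v) y hy]
  ring

theorem shift_preimage_periodicBC (v : X d) : shift v ⁻¹' periodicBC L s = periodicBC L s := by
  ext f
  refine ⟨fun h => ?_, fun h => shift_mem_periodicBC h v⟩
  rw [← shift_neg_shift v f]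
  exact shift_mem_periodicBC h _

theorem mem_image_periodicBC {u : X d → ℤ} (hu : IsHeight u) (h0 : u 0 = 0)
    (hper : IsPeriodicUpTo L s u) : u ∈ HeightFunction.toFun '' periodicBC L s :=
  ⟨⟨u, hu.1, hu.2⟩, ⟨h0, hper⟩, rfl⟩

theorem isTranslationLattice_periodicBC :
    IsTranslationLattice ((d : ℤ) + 1) (HeightFunction.toFun '' periodicBC L s) where
  inf_mem := by
    rintro _ ⟨f, hf, rfl⟩ _ ⟨h, hh, rfl⟩
    exact mem_image_periodicBC (f.isHeight.inf h.isHeight) (by simp [hf.1, hh.1])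
      (IsPeriodicUpTo.inf hf.2 hh.2)
  sup_mem := by
    rintro _ ⟨f, hf, rfl⟩ _ ⟨h, hh, rfl⟩
    exact mem_image_periodicBC (f.isHeight.sup h.isHeight) (by simp [hf.1, hh.1])
      (IsPeriodicUpTo.sup hf.2 hh.2)
  inf_add_mem := by
    rintro _ ⟨f, hf, rfl⟩ _ ⟨h, hh, rfl⟩
    refine mem_image_periodicBC (f.isHeight.inf (h.isHeight.add_const dvd_rfl)) ?_
      (IsPeriodicUpTo.inf hf.2 (IsPeriodicUpTo.add_const hh.2 _))
    simp only [Pi.inf_apply, hf.1, hh.1]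
    omega
  sub_sup_mem := by
    rintro _ ⟨f, hf, rfl⟩ _ ⟨h, hh, rfl⟩
    refine mem_image_periodicBC ((f.isHeight.add_const (dvd_neg.mpr dvd_rfl)).sup h.isHeight) ?_
      (IsPeriodicUpTo.sup (IsPeriodicUpTo.add_const hf.2 _) hh.2)
    simp only [Pi.sup_apply, hf.1, hh.1]
    omega

theorem finiteIndex_range_nsmul {A : Type*} [AddCommGroup A] [AddGroup.FG A] {n : ℕ}
    (hn : n ≠ 0) : (nsmulAddMonoidHom (α := A) n).range.FiniteIndex := by
  have htorsion : IsAddTorsion (A ⧸ (nsmulAddMonoidHom (α := A) n).range) := by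
    intro q
    obtain ⟨x, rfl⟩ := QuotientAddGroup.mk_surjective q
    refine isOfFinAddOrder_iff_nsmul_eq_zero.mpr ⟨n, Nat.pos_of_ne_zero hn, ?_⟩
    rw [← QuotientAddGroup.mk_nsmul, QuotientAddGroup.eq_zero_iff]
    exact ⟨x, rfl⟩
  have := AddCommGroup.finite_of_fg_isAddTorsion _ htorsion
  exact AddSubgroup.finiteIndex_of_finite_quotient

instance finiteIndex_latticeN (n : ℕ) [NeZero n] : (latticeN d n).FiniteIndex := by
  have : AddGroup.FG (X d) := QuotientAddGroup.fg _
  exact finiteIndex_range_nsmul (mul_ne_zero (NeZero.ne n) d.succ_ne_zero)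

theorem finite_periodicBC [L.FiniteIndex] : (periodicBC L s).Finite := by
  have := Fintype.ofFinite (X d ⧸ L)
  have := Classical.decEq (X d ⧸ L)
  choose B hB using HeightFunction.exists_forall_abs_sub_le (d := d)
  let r : X d ⧸ L → X d := Quotient.out
  refine Set.Finite.of_finite_image (f := fun f : HeightFunction d => fun q => f (r q)) ?_ ?_
  · refine (Set.finite_Icc (fun q => -B (r q)) fun q => B (r q)).subset ?_
    rintro _ ⟨f, hf, rfl⟩
    have hbound : ∀ q, |f (r q)| ≤ B (r q) := fun q => by simpa [hf.1] using hB (r q) f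
    exact ⟨fun q => (abs_le.mp (hbound q)).1, fun q => (abs_le.mp (hbound q)).2⟩
  · intro f hf h hh hfh
    ext x
    obtain ⟨y, hy⟩ := QuotientAddGroup.mk_out_eq_add L x
    have hfr : f (r x) = h (r x) := congrFun hfh x
    have hfx := hf.2 x y y.2
    have hhx := hh.2 x y y.2
    rw [← hy] at hfx hhx
    change (f (r x) : ℝ) = _ at hfx
    change (h (r x) : ℝ) = _ at hhx
    rw [hfr, hhx, add_left_inj] at hfx
    exact_mod_cast hfx.symm

end Periodic

section FloorCongr

/-- The largest integer congruent to `σ` modulo `D` that does not exceed `t`. -/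
def floorCongr (D σ : ℤ) (t : ℝ) : ℤ :=
  σ + D * ⌊(t - σ) / D⌋

variable {D : ℤ}

theorem floorCongr_add_mul (hD : D ≠ 0) (σ k : ℤ) (t : ℝ) :
    floorCongr D (σ + D * k) t = floorCongr D σ t := by
  have hD' : (D : ℝ) ≠ 0 := Int.cast_ne_zero.mpr hD
  have hquot : (t - (σ + D * k : ℤ)) / D = (t - σ) / D - (k : ℤ) := by
    push_cast
    field_simp
    ring
  rw [floorCongr, hquot, Int.floor_sub_intCast, floorCongr]
  ring

theorem floorCongr_add_intCast_mul (hD : D ≠ 0) (σ m : ℤ) (t : ℝ) :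
    floorCongr D σ (t + D * m) = floorCongr D σ t + D * m := by
  have hD' : (D : ℝ) ≠ 0 := Int.cast_ne_zero.mpr hD
  have hquot : (t + D * m - σ) / D = (t - σ) / D + m := by
    field_simp
    ring
  rw [floorCongr, hquot, Int.floor_add_intCast, floorCongr]
  ring

theorem floorCongr_add_one_sub (hD : 0 < D) (σ : ℤ) (t : ℝ) {δ : ℝ} (hlo : 1 - D ≤ δ)
    (hhi : δ ≤ 1) :
    floorCongr D (σ + 1) (t + δ) - floorCongr D σ t = 1 - D ∨
      floorCongr D (σ + 1) (t + δ) - floorCongr D σ t = 1 := by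
  have hD' : (0 : ℝ) < D := Int.cast_pos.mpr hD
  set q : ℝ := (t - σ) / D with hq
  have hquot : (t + δ - (σ + 1 : ℤ)) / D = q + (δ - 1) / D := by
    push_cast
    rw [hq]
    ring
  have hle : (δ - 1) / D ≤ 0 := div_nonpos_of_nonpos_of_nonneg (by linarith) hD'.le
  have hge : -1 ≤ (δ - 1) / D := by
    rw [le_div_iff₀ hD']
    linarith
  have hfloor_le : ⌊q + (δ - 1) / D⌋ ≤ ⌊q⌋ := Int.floor_le_floor (by linarith)
  have hle_floor : ⌊q⌋ - 1 ≤ ⌊q + (δ - 1) / D⌋ := by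
    rw [← Int.floor_sub_one]
    exact Int.floor_le_floor (by linarith)
  rw [floorCongr, floorCongr, hquot]
  obtain h | h : ⌊q + (δ - 1) / D⌋ = ⌊q⌋ - 1 ∨ ⌊q + (δ - 1) / D⌋ = ⌊q⌋ := by omega
  · exact Or.inl (by rw [h]; ring)
  · exact Or.inr (by rw [h]; ring)

end FloorCongr

section FloorHeight

variable {d : ℕ} {s : Module.Dual ℝ (H d)}

theorem sum_slope_eq_zero (s : Module.Dual ℝ (H d)) : ∑ i, s (embed d (g i)) = 0 := by
  rw [← map_sum, ← map_sum, sum_g, map_zero, map_zero]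

theorem neg_le_slope (hs : s ∈ slopes d) (i : Fin (d + 1)) : -(d : ℝ) ≤ s (embed d (g i)) := by
  have hsum := sum_slope_eq_zero s
  rw [← Finset.add_sum_erase _ _ (Finset.mem_univ i)] at hsum
  have hle : ∑ j ∈ Finset.univ.erase i, s (embed d (g j)) ≤ (Finset.univ.erase i).card • (1 : ℝ) :=
    Finset.sum_le_card_nsmul _ _ _ fun j _ => hs j
  rw [Finset.card_erase_of_mem (Finset.mem_univ i), Finset.card_univ, Fintype.card_fin,
    add_tsub_cancel_right, nsmul_eq_mul, mul_one] at hle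
  linarith

/-- The largest height function below the linear function `s`. At the class of `v`, heights are
congruent to `∑ i, v i` modulo `d + 1`. -/
def floorHeight (s : Module.Dual ℝ (H d)) (x : X d) : ℤ :=
  Quotient.liftOn' x
    (fun v => floorCongr (d + 1) (∑ i, v i) (s (embed d (QuotientAddGroup.mk v)))) fun v w hvw => by
      have hmk : (QuotientAddGroup.mk v : X d) = QuotientAddGroup.mk w := Quotient.sound' hvw
      obtain ⟨k, hk⟩ := AddSubgroup.mem_zmultiples_iff.mp (QuotientAddGroup.eq.mp hmk)
      have hsum : ∑ i, w i = ∑ i, v i + (d + 1) * k := by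
        rw [neg_add_eq_iff_eq_add.mp hk.symm]
        simp [Finset.sum_add_distrib]
      simp only [hmk, hsum]
      exact (floorCongr_add_mul (by positivity) _ _ _).symm

theorem floorHeight_mk (s : Module.Dual ℝ (H d)) (v : Fin (d + 1) → ℤ) :
    floorHeight s (QuotientAddGroup.mk v) =
      floorCongr (d + 1) (∑ i, v i) (s (embed d (QuotientAddGroup.mk v))) :=
  rfl

theorem floorHeight_zero (s : Module.Dual ℝ (H d)) : floorHeight s 0 = 0 := by
  change floorCongr (d + 1) (∑ i, (0 : Fin (d + 1) → ℤ) i) (s (embed d 0)) = 0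
  simp [floorCongr]

theorem floorHeight_add_g_sub (hs : s ∈ slopes d) (x : X d) (i : Fin (d + 1)) :
    floorHeight s (x + g i) - floorHeight s x = -(d : ℤ) ∨
      floorHeight s (x + g i) - floorHeight s x = 1 := by
  obtain ⟨v, rfl⟩ := QuotientAddGroup.mk_surjective x
  have hmk : (QuotientAddGroup.mk v + g i : X d) = QuotientAddGroup.mk (v + Pi.single i 1) := rfl
  have hsum : ∑ j, (v + Pi.single i 1 : Fin (d + 1) → ℤ) j = ∑ j, v j + 1 := by
    simp [Finset.sum_add_distrib]
  have hlo : 1 - ((d + 1 : ℤ) : ℝ) ≤ s (embed d (g i)) := by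
    push_cast
    linarith [neg_le_slope hs i]
  have key := floorCongr_add_one_sub (D := d + 1) (by positivity) (∑ j, v j)
    (s (embed d (QuotientAddGroup.mk v))) hlo (hs i)
  rwa [← map_add, ← map_add, hmk, ← hsum, ← floorHeight_mk, ← floorHeight_mk,
    sub_add_cancel_right] at key

theorem exists_slope_eq_div_of_mem_slopesN {n : ℕ} (hs : s ∈ slopesN d n) (x : X d) :
    ∃ k : ℤ, s (embed d x) = k / n := by
  choose k hk using hs.2
  obtain ⟨v, rfl⟩ := QuotientAddGroup.mk_surjective x
  refine ⟨∑ i, v i * k i, ?_⟩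
  rw [mk_eq_sum_zsmul_g, map_sum, map_sum, Int.cast_sum, Finset.sum_div]
  refine Finset.sum_congr rfl fun i _ => ?_
  rw [map_zsmul, map_zsmul, zsmul_eq_mul, hk, Int.cast_mul, mul_div_assoc]

theorem isPeriodicUpTo_floorHeight {n : ℕ} [NeZero n] (hs : s ∈ slopesN d n) :
    IsPeriodicUpTo (latticeN d n) s (floorHeight s) := by
  rintro x _ ⟨y, rfl⟩
  obtain ⟨m, hm⟩ := exists_slope_eq_div_of_mem_slopesN hs y
  obtain ⟨v, rfl⟩ := QuotientAddGroup.mk_surjective x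
  obtain ⟨w, rfl⟩ := QuotientAddGroup.mk_surjective y
  have hslope : s (embed d ((n * (d + 1)) • QuotientAddGroup.mk w)) = ((d + 1 : ℤ) : ℝ) * m := by
    have hn : (n : ℝ) ≠ 0 := NeZero.ne _
    rw [map_nsmul, map_nsmul, hm, nsmul_eq_mul]
    push_cast
    field_simp
  have hsum : ∑ i, (v + (n * (d + 1)) • w) i = ∑ i, v i + (d + 1) * (n * ∑ i, w i) := by
    simp only [Pi.add_apply, Pi.smul_apply, Finset.sum_add_distrib, ← Finset.smul_sum]
    rw [nsmul_eq_mul]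
    push_cast
    ring
  have hD : (d + 1 : ℤ) ≠ 0 := by positivity
  rw [nsmulAddMonoidHom_apply, hslope, ← QuotientAddGroup.mk_nsmul, ← QuotientAddGroup.mk_add,
    floorHeight_mk, floorHeight_mk, hsum, floorCongr_add_mul hD, QuotientAddGroup.mk_add,
    QuotientAddGroup.mk_nsmul, map_add, map_add, hslope, floorCongr_add_intCast_mul hD]
  push_cast
  ring

theorem nonempty_periodicBC {n : ℕ} [NeZero n] (hs : s ∈ slopesN d n) :
    (periodicBC (latticeN d n) s).Nonempty :=
  ⟨⟨floorHeight s, by simp [floorHeight_zero], floorHeight_add_g_sub hs.1⟩, floorHeight_zero s,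
    isPeriodicUpTo_floorHeight hs⟩

end FloorHeight

section PeriodicMoments

open scoped BigOperators

variable {d : ℕ} {L : AddSubgroup (X d)} [L.FiniteIndex] {s : Module.Dual ℝ (H d)}

theorem expect_shift_periodicBC (v : X d) (F : HeightFunction d → ℝ) :
    𝔼 f ∈ (finite_periodicBC (L := L) (s := s)).toFinset, F (shift v f) =
      𝔼 f ∈ (finite_periodicBC (L := L) (s := s)).toFinset, F f :=
  Finset.expect_nbij' (shift v) (shift (-v))
    (fun f hf => by
      rw [Set.Finite.mem_toFinset] at hf ⊢
      exact shift_mem_periodicBC hf v)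
    (fun f hf => by
      rw [Set.Finite.mem_toFinset] at hf ⊢
      exact shift_mem_periodicBC hf (-v))
    (fun f _ => shift_neg_shift v f) (fun f _ => shift_shift_neg v f) fun _ _ => rfl

theorem expect_periodicBC (hne : (periodicBC L s).Nonempty) (x : X d) :
    𝔼 f ∈ (finite_periodicBC (L := L) (s := s)).toFinset, (f x : ℝ) = s (embed d x) := by
  set Ω := (finite_periodicBC (L := L) (s := s)).toFinset
  have hmem : ∀ {f}, f ∈ Ω → f ∈ periodicBC L s := (Set.Finite.mem_toFinset _).mp
  have hadd : ∀ y z : X d, 𝔼 f ∈ Ω, (f (y + z) : ℝ) = 𝔼 f ∈ Ω, (f y : ℝ) + 𝔼 f ∈ Ω, (f z : ℝ) := by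
    intro y z
    rw [← expect_shift_periodicBC z fun f => (f y : ℝ), ← Finset.expect_add_distrib]
    exact Finset.expect_congr rfl fun f hf => by simp [shift, (hmem hf).1]
  let mean : X d →+ ℝ := AddMonoidHom.mk' (fun y => 𝔼 f ∈ Ω, (f y : ℝ)) hadd
  have hmean_index : mean (L.index • x) = s (embed d (L.index • x)) := by
    calc mean (L.index • x) = 𝔼 _f ∈ Ω, s (embed d (L.index • x)) :=
          Finset.expect_congr rfl fun f hf => by
            simpa [(hmem hf).1] using (hmem hf).2 0 _ (L.nsmul_index_mem x)
      _ = s (embed d (L.index • x)) :=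
          Finset.expect_const ((Set.Finite.toFinset_nonempty _).mpr hne) _
  rw [map_nsmul, map_nsmul, map_nsmul] at hmean_index
  exact (smul_right_inj AddSubgroup.FiniteIndex.index_ne_zero).mp hmean_index

theorem centeredMGF_periodicBC_le (x y : X d) (l : ℝ) :
    centeredMGF (finite_periodicBC (L := L) (s := s)).toFinset (fun f => (f (y - x) : ℝ)) l ≤
      Real.exp (l ^ 2 * ((d : ℝ) + 1) ^ 2 / 2) ^ (graph d).dist x y := by
  classical
  set Ω := (finite_periodicBC (L := L) (s := s)).toFinset
  obtain ⟨p, hp⟩ := exists_walk_zero_length_eq_dist x y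
  have htoFun : Function.Injective (HeightFunction.toFun : HeightFunction d → X d → ℤ) :=
    fun f h hfh => HeightFunction.ext (congrFun hfh)
  have hlattice : IsTranslationLattice ((d : ℤ) + 1)
      (Ω.image HeightFunction.toFun : Set (X d → ℤ)) := by
    rw [Finset.coe_image, Set.Finite.coe_toFinset]
    exact isTranslationLattice_periodicBC
  have key := hlattice.centeredMGF_le (by positivity) l p
    (fun a b hab => by
      obtain ⟨c, hc⟩ := HeightFunction.sub_eq_or_of_adj hab
      exact ⟨c, Finset.forall_mem_image.mpr fun f _ => hc f⟩)
    ⟨0, Finset.forall_mem_image.mpr fun f hf => ((Set.Finite.mem_toFinset _).mp hf).1⟩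
  rw [hp, centeredMGF, Finset.expect_image htoFun.injOn, Finset.expect_image htoFun.injOn] at key
  exact_mod_cast key

theorem expect_exp_periodicBC_le (hne : (periodicBC L s).Nonempty) (x y : X d) (l : ℝ) :
    𝔼 f ∈ (finite_periodicBC (L := L) (s := s)).toFinset,
        Real.exp (l * ((f y : ℝ) - f x - s (embed d (y - x)))) ≤
      Real.exp (l ^ 2 * ((d : ℝ) + 1) ^ 2 / 2) ^ (graph d).dist x y := by
  refine le_of_eq_of_le ?_ (centeredMGF_periodicBC_le (L := L) (s := s) x y l)
  rw [centeredMGF, expect_periodicBC hne,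
    ← expect_shift_periodicBC x fun f => Real.exp (l * (f (y - x) - s (embed d (y - x))))]
  refine Finset.expect_congr rfl fun f hf => ?_
  simp [shift, ((Set.Finite.mem_toFinset _).mp hf).1]

end PeriodicMoments

section Local

variable {d : ℕ}

theorem measurable_sub (x y : X d) : Measurable fun f : HeightFunction d => f x - f y := by
  rw [measurable_iff_comap_le]
  exact le_iSup₂_of_le (f := fun x y : X d =>
    MeasurableSpace.comap (fun f : HeightFunction d => f x - f y) ⊤) x y le_rfl

theorem measurable_of_measurable_sub {α : Type*} [MeasurableSpace α]
    {φ : α → HeightFunction d} (h : ∀ x y, Measurable fun a => φ a x - φ a y) : Measurable φ := by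
  rw [measurable_iff_comap_le]
  change MeasurableSpace.comap φ (⨆ (x : X d) (y : X d),
    MeasurableSpace.comap (fun f : HeightFunction d => f x - f y) ⊤) ≤ _
  simp only [MeasurableSpace.comap_iSup, MeasurableSpace.comap_comp]
  exact iSup₂_le fun x y => (h x y).comap_le

theorem measurable_shift (v : X d) : Measurable (shift v : HeightFunction d → _) :=
  measurable_of_measurable_sub fun x y => by
    simpa [shift] using measurable_sub (x + v) (y + v)

/-- The differences of the heights on `R` to the height at the origin. -/
def gradientOn (R : Finset (X d)) (f : HeightFunction d) : R → ℤ := fun x => f x - f 0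

theorem gradientOn_eq_iff {R : Finset (X d)} {f h : HeightFunction d} :
    gradientOn R f = gradientOn R h ↔ ∀ x ∈ R, f x - f 0 = h x - h 0 := by
  simp [funext_iff, gradientOn]

theorem measurable_gradientOn (R : Finset (X d)) : Measurable (gradientOn R) :=
  measurable_pi_iff.mpr fun _ => measurable_sub _ _

theorem finite_range_gradientOn (R : Finset (X d)) : (Set.range (gradientOn R)).Finite := by
  choose B hB using HeightFunction.exists_forall_abs_sub_le (d := d)
  refine (Set.finite_Icc (fun x : R => -B x) fun x : R => B x).subset ?_
  rintro _ ⟨f, rfl⟩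
  exact ⟨fun x => (abs_le.mp (hB x f)).1, fun x => (abs_le.mp (hB x f)).2⟩

/-- `F` depends only on the height differences between vertices of `R` and the origin. Local
events are the sets `A` for which the predicate `(· ∈ A)` is local. -/
def IsLocal {β : Type*} (R : Finset (X d)) (F : HeightFunction d → β) : Prop :=
  ∀ f h : HeightFunction d, (∀ x ∈ R, f x - f 0 = h x - h 0) → F f = F h

theorem IsLocal.mono {β : Type*} {R R' : Finset (X d)} {F : HeightFunction d → β}
    (hF : IsLocal R F) (h : R ⊆ R') : IsLocal R' F :=
  fun f f' hff' => hF f f' fun x hx => hff' x (h hx)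

theorem IsLocal.measurable {β : Type*} [MeasurableSpace β] {R : Finset (X d)}
    {F : HeightFunction d → β} (hF : IsLocal R F) : Measurable F := by
  intro t _
  have hpreimage : F ⁻¹' t = gradientOn R ⁻¹' (gradientOn R '' (F ⁻¹' t)) := by
    refine (Set.subset_preimage_image _ _).antisymm ?_
    rintro f ⟨h, hh, hhf⟩
    rwa [Set.mem_preimage, ← hF h f (gradientOn_eq_iff.mp hhf)]
  rw [hpreimage]
  exact measurable_gradientOn R (Set.to_countable _).measurableSet

theorem IsLocal.measurableSet {R : Finset (X d)} {A : Set (HeightFunction d)}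
    (hA : IsLocal R (· ∈ A)) : MeasurableSet A :=
  measurableSet_setOfPred.mpr hA.measurable

/-- The events that depend on finitely many height differences; they form a `π`-system that
generates `ℱ^∇`. -/
def localEvents (d : ℕ) : Set (Set (HeightFunction d)) :=
  {A | ∃ R : Finset (X d), IsLocal R (· ∈ A)}

theorem isPiSystem_localEvents : IsPiSystem (localEvents d) := by
  classical
  rintro A ⟨R, hR⟩ B ⟨R', hR'⟩ -
  refine ⟨R ∪ R', fun f h hfh => ?_⟩
  exact congrArg₂ And (hR.mono Finset.subset_union_left f h hfh)
    (hR'.mono Finset.subset_union_right f h hfh)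

theorem gradientField_eq_generateFrom_localEvents :
    gradientField d = MeasurableSpace.generateFrom (localEvents d) := by
  classical
  apply le_antisymm
  · refine iSup₂_le fun x y => ?_
    rintro _ ⟨t, -, rfl⟩
    refine MeasurableSpace.measurableSet_generateFrom ⟨{x, y}, fun f h hfh => ?_⟩
    have hx := hfh x (by simp)
    have hy := hfh y (by simp)
    have hxy : f x - f y = h x - h y := by linarith
    simp only [Set.mem_preimage, hxy]
  · exact MeasurableSpace.generateFrom_le fun A ⟨R, hR⟩ => hR.measurableSet

theorem ext_of_isLocal {μ ν : Measure (HeightFunction d)} [IsProbabilityMeasure μ]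
    [IsProbabilityMeasure ν] (h : ∀ R : Finset (X d), ∀ A, IsLocal R (· ∈ A) → μ A = ν A) :
    μ = ν :=
  ext_of_generate_finite _ gradientField_eq_generateFrom_localEvents isPiSystem_localEvents
    (fun A ⟨R, hR⟩ => h R A hR) (by simp)

/-- The height function with the same gradient that vanishes at the origin. -/
def normalize (f : HeightFunction d) : HeightFunction d where
  toFun x := f x - f 0
  zero_dvd := by simp
  grad_mem x i := by simpa using f.grad_mem x i

theorem normalize_mem_iff {A : Set (HeightFunction d)} (hA : MeasurableSet A)
    (f : HeightFunction d) : normalize f ∈ A ↔ f ∈ A := by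
  have hle : gradientField d ≤ MeasurableSpace.comap normalize ⊤ := by
    refine iSup₂_le fun x y => ?_
    rintro _ ⟨t, -, rfl⟩
    refine ⟨(fun f : HeightFunction d => f x - f y) ⁻¹' t, trivial, ?_⟩
    ext f
    simp [normalize]
  obtain ⟨B, -, rfl⟩ := hle _ hA
  have hidem : normalize (normalize f) = normalize f := by
    ext x
    simp [normalize]
  simp only [Set.mem_preimage, hidem]

theorem mem_iff_of_measurableSet_fieldOn {R : Set (X d)} {A : Set (HeightFunction d)}
    (hA : MeasurableSet[fieldOn R] A) {f h : HeightFunction d} (hfh : ∀ x ∈ R, f x = h x) :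
    f ∈ A ↔ h ∈ A := by
  have hle : fieldOn R ≤ MeasurableSpace.comap (fun (f : HeightFunction d) (x : R) => f x) ⊤ := by
    refine iSup₂_le fun x hx => ?_
    rintro _ ⟨t, -, rfl⟩
    exact ⟨(fun u : R → ℤ => u ⟨x, hx⟩) ⁻¹' t, trivial, rfl⟩
  obtain ⟨B, -, rfl⟩ := hle _ hA
  have hrestrict : (fun x : R => f x) = fun x : R => h x := funext fun x => hfh x x.2
  simp only [Set.mem_preimage, hrestrict]

theorem isLocal_of_measurableSet {R : Finset (X d)} {A : Set (HeightFunction d)}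
    (hA : MeasurableSet A) (hR : MeasurableSet[fieldOn (R : Set (X d))] A) :
    IsLocal R (· ∈ A) := by
  intro f h hfh
  change (f ∈ A) = (h ∈ A)
  rw [← normalize_mem_iff hA f, ← normalize_mem_iff hA h]
  exact propext (mem_iff_of_measurableSet_fieldOn hR hfh)

end Local

section LocalLimits

variable {d : ℕ}

/-- The height functions that vanish at the origin, as a compact set of functions for the product
topology; it is a set of representatives for the gradients. -/
def pinned (d : ℕ) : Set (X d → ℤ) := {u | IsHeight u ∧ u 0 = 0}

theorem isClosed_pinned : IsClosed (pinned d) := by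
  have hpinned : pinned d = {u | u 0 = 0} ∩
      ⋂ (x : X d) (i : Fin (d + 1)), {u | u (x + g i) - u x ∈ ({-(d : ℤ), 1} : Set ℤ)} := by
    ext u
    simp only [pinned, IsHeight, Set.mem_ofPred_eq, Set.mem_inter_iff, Set.mem_iInter,
      Set.mem_insert_iff, Set.mem_singleton_iff]
    exact ⟨fun h => ⟨h.2, h.1.2⟩, fun h => ⟨⟨h.1 ▸ dvd_zero _, h.2⟩, h.1⟩⟩
  rw [hpinned]
  refine IsClosed.inter (isClosed_eq (continuous_apply _) continuous_const)
    (isClosed_iInter fun x => isClosed_iInter fun i => ?_)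
  exact (isClosed_discrete ({-(d : ℤ), 1} : Set ℤ)).preimage
    (f := fun u : X d → ℤ => u (x + g i) - u x) ((continuous_apply _).sub (continuous_apply _))

theorem isCompact_pinned : IsCompact (pinned d) := by
  choose B hB using HeightFunction.exists_forall_abs_sub_le (d := d)
  have hbox : IsCompact (Set.univ.pi fun x : X d => Set.Icc (-B x) (B x)) :=
    isCompact_univ_pi fun x => (Set.finite_Icc _ _).isCompact
  refine hbox.of_isClosed_subset isClosed_pinned fun u hu x _ => ?_
  have hux : |u x - u 0| ≤ B x := hB x ⟨u, hu.1.1, hu.1.2⟩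
  rwa [hu.2, sub_zero, abs_le] at hux

instance : Countable (X d) := inferInstanceAs (Countable (Quotient _))

instance : CompactSpace (pinned d) := isCompact_iff_compactSpace.mp isCompact_pinned

/-- The inclusion of the pinned height functions into `HeightFunction d`. -/
def ofPinned (u : pinned d) : HeightFunction d := ⟨u.1, u.2.1.1, u.2.1.2⟩

/-- The pinned height function with the same gradient. -/
def toPinned (f : HeightFunction d) : pinned d :=
  ⟨(normalize f).toFun, (normalize f).isHeight, by simp [normalize]⟩

theorem measurable_ofPinned : Measurable (ofPinned : pinned d → HeightFunction d) :=
  measurable_of_measurable_sub fun x y =>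
    ((measurable_pi_apply x).comp measurable_subtype_coe).sub
      ((measurable_pi_apply y).comp measurable_subtype_coe)

theorem measurable_toPinned : Measurable (toPinned : HeightFunction d → pinned d) :=
  Measurable.subtype_mk (measurable_pi_iff.mpr fun _ => measurable_sub _ _)

namespace IsLocal

theorem continuous_comp_ofPinned {β : Type*} [TopologicalSpace β] {R : Finset (X d)}
    {F : HeightFunction d → β} (hF : IsLocal R F) : Continuous (F ∘ ofPinned) := by
  refine IsLocallyConstant.continuous ((IsLocallyConstant.iff_exists_open _).mpr fun u => ?_)
  refine ⟨⋂ x ∈ R, {v : pinned d | v.1 x = u.1 x}, ?_, by simp, ?_⟩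
  · refine isOpen_biInter_finset fun x _ => ?_
    exact (isOpen_discrete ({u.1 x} : Set ℤ)).preimage (f := fun v : pinned d => v.1 x)
      ((continuous_apply x).comp continuous_subtype_val)
  · intro v hv
    refine hF _ _ fun x hx => ?_
    have hvx : v.1 x = u.1 x := Set.mem_iInter₂.mp hv x hx
    simp [ofPinned, hvx, u.2.2, v.2.2]

theorem apply_ofPinned_toPinned {β : Type*} {R : Finset (X d)} {F : HeightFunction d → β}
    (hF : IsLocal R F) (f : HeightFunction d) : F (ofPinned (toPinned f)) = F f :=
  hF _ _ fun x _ => by simp [ofPinned, toPinned, normalize]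

variable {R : Finset (X d)} {F : HeightFunction d → ℝ}

theorem integral_map_toPinned (hF : IsLocal R F) (ν : Measure (HeightFunction d)) :
    ∫ u, F (ofPinned u) ∂(ν.map toPinned) = ∫ f, F f ∂ν := by
  refine (integral_map (f := F ∘ ofPinned) measurable_toPinned.aemeasurable
    (hF.measurable.comp measurable_ofPinned).stronglyMeasurable.aestronglyMeasurable).trans ?_
  exact integral_congr_ae (Eventually.of_forall hF.apply_ofPinned_toPinned)

theorem exists_norm_le (hF : IsLocal R F) : ∃ C, ∀ f, ‖F f‖ ≤ C := by
  obtain ⟨C, hC⟩ := (isCompact_range hF.continuous_comp_ofPinned).isBounded.exists_norm_le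
  exact ⟨C, fun f => hF.apply_ofPinned_toPinned f ▸ hC _ ⟨toPinned f, rfl⟩⟩

theorem integrable (hF : IsLocal R F) (μ : Measure (HeightFunction d)) [IsFiniteMeasure μ] :
    Integrable F μ := by
  obtain ⟨C, hC⟩ := hF.exists_norm_le
  exact Integrable.of_bound hF.measurable.stronglyMeasurable.aestronglyMeasurable C
    (Eventually.of_forall hC)

end IsLocal

/-- Convergence of the integrals of all functions of finitely many height differences. -/
def IsLocalLimit (ν : ℕ → Measure (HeightFunction d)) (μ : Measure (HeightFunction d)) : Prop :=
  ∀ (R : Finset (X d)) (F : HeightFunction d → ℝ), IsLocal R F →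
    Tendsto (fun j => ∫ f, F f ∂(ν j)) atTop (𝓝 (∫ f, F f ∂μ))

theorem exists_isLocalLimit_subseq (ν : ℕ → Measure (HeightFunction d))
    [∀ n, IsProbabilityMeasure (ν n)] :
    ∃ μ : Measure (HeightFunction d), IsProbabilityMeasure μ ∧ ∃ k : ℕ → ℕ, StrictMono k ∧
      IsLocalLimit (fun j => ν (k j)) μ := by
  let ν' : ℕ → ProbabilityMeasure (pinned d) := fun n =>
    ⟨(ν n).map toPinned, Measure.isProbabilityMeasure_map measurable_toPinned.aemeasurable⟩
  obtain ⟨μ', k, hk, hlim⟩ := CompactSpace.tendsto_subseq ν'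
  refine ⟨(μ' : Measure (pinned d)).map ofPinned,
    Measure.isProbabilityMeasure_map measurable_ofPinned.aemeasurable, k, hk, fun R F hF => ?_⟩
  have htendsto := ProbabilityMeasure.tendsto_iff_forall_integral_tendsto.mp hlim
    (BoundedContinuousFunction.mkOfCompact ⟨F ∘ ofPinned, hF.continuous_comp_ofPinned⟩)
  rw [integral_map measurable_ofPinned.aemeasurable
    hF.measurable.stronglyMeasurable.aestronglyMeasurable]
  exact htendsto.congr fun j => hF.integral_map_toPinned (ν (k j))

section

variable {ν : ℕ → Measure (HeightFunction d)} {μ : Measure (HeightFunction d)}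

theorem IsLocalLimit.tendsto_measureReal (h : IsLocalLimit ν μ) {R : Finset (X d)}
    {A : Set (HeightFunction d)} (hA : IsLocal R (· ∈ A)) :
    Tendsto (fun j => (ν j).real A) atTop (𝓝 (μ.real A)) := by
  classical
  have hindicator : IsLocal R (A.indicator (1 : HeightFunction d → ℝ)) := fun f f' hff' => by
    have hmem : (f ∈ A) = (f' ∈ A) := hA f f' hff'
    simp only [Set.indicator_apply, hmem, Pi.one_apply]
  simpa only [integral_indicator_one hA.measurableSet] using h R _ hindicator

variable [∀ n, IsFiniteMeasure (ν n)] [IsFiniteMeasure μ]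

theorem IsLocalLimit.tendsto_measure (h : IsLocalLimit ν μ) {R : Finset (X d)}
    {A : Set (HeightFunction d)} (hA : IsLocal R (· ∈ A)) :
    Tendsto (fun j => ν j A) atTop (𝓝 (μ A)) :=
  (ENNReal.tendsto_toReal_iff (fun _ => measure_ne_top _ _) (measure_ne_top _ _)).mp
    (h.tendsto_measureReal hA)

theorem IsLocalLimit.locallyConverges (h : IsLocalLimit ν μ) : LocallyConverges ν μ := by
  intro R hR A hA hRA
  refine h.tendsto_measure (R := hR.toFinset) (isLocal_of_measurableSet hA ?_)
  rwa [Set.Finite.coe_toFinset]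

end

end LocalLimits

section Uniform

open scoped BigOperators

variable {d : ℕ} {S : Set (HeightFunction d)}

theorem uniformMeasure_eq_sum_dirac (hS : S.Finite) :
    uniformMeasure S = (hS.toFinset.card : ℝ≥0∞)⁻¹ • ∑ f ∈ hS.toFinset, Measure.dirac f := by
  have := hS.fintype
  rw [uniformMeasure, Measure.sum_fintype, hS.encard_eq_coe_toFinset_card,
    ← Finset.sum_coe_sort hS.toFinset]
  congr 1
  exact Fintype.sum_equiv (Equiv.subtypeEquivRight fun f => hS.mem_toFinset.symm) _ _
    fun f => rfl

theorem uniformMeasure_apply (hS : S.Finite) {A : Set (HeightFunction d)} (hA : MeasurableSet A) :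
    uniformMeasure S A = ((S ∩ A).ncard : ℝ≥0∞) / (S.ncard : ℝ≥0∞) := by
  classical
  have hfilter : {f ∈ hS.toFinset | f ∈ A} = (hS.inter_of_left A).toFinset := by
    ext f
    simp
  rw [uniformMeasure_eq_sum_dirac hS, Measure.smul_apply, Measure.finsetSum_apply, smul_eq_mul,
    Finset.sum_congr rfl fun f _ => Measure.dirac_apply' f hA, div_eq_mul_inv, mul_comm,
    Set.ncard_eq_toFinset_card S hS, Set.ncard_eq_toFinset_card (S ∩ A) (hS.inter_of_left A),
    ← hfilter]
  simp [Set.indicator_apply]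

theorem isProbabilityMeasure_uniformMeasure (hS : S.Finite) (hne : S.Nonempty) :
    IsProbabilityMeasure (uniformMeasure S) := by
  constructor
  rw [uniformMeasure_apply hS MeasurableSet.univ, Set.inter_univ]
  exact ENNReal.div_self (by simpa using ((Set.ncard_pos hS).mpr hne).ne') (by simp)

theorem integral_uniformMeasure (hS : S.Finite) {F : HeightFunction d → ℝ} (hF : Measurable F) :
    ∫ f, F f ∂(uniformMeasure S) = 𝔼 f ∈ hS.toFinset, F f := by
  rw [uniformMeasure_eq_sum_dirac hS, integral_smul_measure, integral_finsetSum_measure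
    fun f _ => integrable_dirac' hF.stronglyMeasurable enorm_lt_top,
    Finset.sum_congr rfl fun f _ => integral_dirac' F f hF.stronglyMeasurable,
    Finset.expect_eq_sum_div_card]
  simp [div_eq_inv_mul]

end Uniform

section LatticeSeparation

variable {d : ℕ}

/-- The homomorphism `[v] ↦ v i - v j`; these separate the points of `X d`. -/
def coordDiff (i j : Fin (d + 1)) : X d →+ ℤ :=
  QuotientAddGroup.lift _
    ((Pi.evalAddMonoidHom (fun _ => ℤ) i) - (Pi.evalAddMonoidHom (fun _ => ℤ) j)) (by
      intro x hx
      obtain ⟨k, rfl⟩ := AddSubgroup.mem_zmultiples_iff.mp hx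
      simp)

theorem coordDiff_mk (i j : Fin (d + 1)) (v : Fin (d + 1) → ℤ) :
    coordDiff i j (QuotientAddGroup.mk v) = v i - v j := rfl

theorem exists_coordDiff_ne_zero {x : X d} (hx : x ≠ 0) : ∃ i j, coordDiff i j x ≠ 0 := by
  obtain ⟨v, rfl⟩ := QuotientAddGroup.mk_surjective x
  by_contra! hzero
  have hconst : v = fun _ => v 0 := funext fun i => sub_eq_zero.mp (hzero i 0)
  exact hx (hconst ▸ mk_const (v 0))

theorem infinite_lattice (hd : 1 ≤ d) : Infinite (X d) := by
  refine Infinite.of_surjective (coordDiff (0 : Fin (d + 1)) (Fin.last d)) fun k =>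
    ⟨QuotientAddGroup.mk (Pi.single 0 k), ?_⟩
  have hlast : Fin.last d ≠ 0 := by
    rw [ne_eq, Fin.ext_iff, Fin.val_last, Fin.val_zero]
    omega
  rw [coordDiff_mk, Pi.single_eq_same, Pi.single_eq_of_ne hlast, sub_zero]

theorem eventually_notMem_latticeN {x : X d} (hx : x ≠ 0) : ∀ᶠ n in atTop, x ∉ latticeN d n := by
  obtain ⟨i, j, hij⟩ := exists_coordDiff_ne_zero hx
  filter_upwards [eventually_gt_atTop (coordDiff i j x).natAbs] with n hn
  rintro ⟨y, rfl⟩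
  have hdvd : (n : ℤ) ∣ coordDiff i j ((n * (d + 1)) • y) := by
    rw [map_nsmul, mul_smul, nsmul_eq_mul]
    exact dvd_mul_right _ _
  exact hij (Int.eq_zero_of_dvd_of_natAbs_lt_natAbs hdvd hn)

end LatticeSeparation

section Gluing

variable {d : ℕ} {L : AddSubgroup (X d)} {R : Set (X d)} {T : Finset (X d)}

/-- `T` contains `R`, its neighbours, the origin and a vertex outside `R`, and no two vertices of
`T` are congruent modulo `L`: on such a window a change of heights on `R` can be carried out
independently in all the translates by `L`. -/
structure IsCollar (L : AddSubgroup (X d)) (R : Set (X d)) (T : Finset (X d)) : Prop where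
  subset : ∀ r ∈ R, r ∈ T
  add_mem : ∀ r ∈ R, ∀ i, r + g i ∈ T
  sub_mem : ∀ r ∈ R, ∀ i, r - g i ∈ T
  zero_mem : 0 ∈ T
  exists_notMem : ∃ z ∈ T, z ∉ R
  eq_of_sub_mem : ∀ p ∈ T, ∀ q ∈ T, p - q ∈ L → p = q

theorem exists_isCollar_bot [Infinite (X d)] (hR : R.Finite) (T₀ : Finset (X d)) :
    ∃ T, T₀ ⊆ T ∧ IsCollar ⊥ R T := by
  classical
  obtain ⟨z, hz⟩ := hR.exists_notMem
  let N : Finset (X d) :=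
    hR.toFinset ∪ Finset.univ.biUnion fun i => hR.toFinset.image (· + g i) ∪
      hR.toFinset.image (· - g i)
  have hN : ∀ r ∈ R, ∀ i, r ∈ N ∧ r + g i ∈ N ∧ r - g i ∈ N := by
    intro r hr i
    simp only [N, Finset.mem_union, Finset.mem_biUnion, Finset.mem_image, hR.mem_toFinset]
    exact ⟨Or.inl hr, Or.inr ⟨i, Finset.mem_univ i, Or.inl ⟨r, hr, rfl⟩⟩,
      Or.inr ⟨i, Finset.mem_univ i, Or.inr ⟨r, hr, rfl⟩⟩⟩
  have hsub : N ⊆ T₀ ∪ (N ∪ {0, z}) := Finset.subset_union_left.trans Finset.subset_union_right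
  exact ⟨T₀ ∪ (N ∪ {0, z}), Finset.subset_union_left,
    { subset := fun r hr => hsub (hN r hr 0).1
      add_mem := fun r hr i => hsub (hN r hr i).2.1
      sub_mem := fun r hr i => hsub (hN r hr i).2.2
      zero_mem := by simp
      exists_notMem := ⟨z, by simp, hz⟩
      eq_of_sub_mem := fun _ _ _ _ h => sub_eq_zero.mp (AddSubgroup.mem_bot.mp h) }⟩

theorem IsCollar.eventually (hT : IsCollar L R T) {ι : Type*} {l : Filter ι}
    {M : ι → AddSubgroup (X d)} (hM : ∀ x ≠ 0, ∀ᶠ j in l, x ∉ M j) :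
    ∀ᶠ j in l, IsCollar (M j) R T := by
  have heq : ∀ᶠ j in l, ∀ p ∈ T, ∀ q ∈ T, p - q ∈ M j → p = q := by
    simp only [Filter.eventually_all_finset]
    intro p _ q _
    by_cases hpq : p = q
    · exact Eventually.of_forall fun _ _ => hpq
    · exact (hM _ (sub_ne_zero.mpr hpq)).mono fun j hj hmem => absurd hmem hj
  exact heq.mono fun j hj => { hT with eq_of_sub_mem := hj }

theorem IsCollar.bot (hT : IsCollar L R T) : IsCollar ⊥ R T :=
  { hT with eq_of_sub_mem := fun _ _ _ _ h => sub_eq_zero.mp (AddSubgroup.mem_bot.mp h) }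

theorem IsCollar.add_notMem (hT : IsCollar L R T) {p : X d} (hp : p ∈ T) (hpR : p ∉ R) :
    ∀ y ∈ L, p + y ∉ R := by
  intro y hy hmem
  have hpy : p + y = p := hT.eq_of_sub_mem _ (hT.subset _ hmem) p hp (by simpa using hy)
  exact hpR (hpy ▸ hmem)

open Classical in
/-- The function `f` with its values on `R` changed to those of `h`, this change being repeated
periodically with respect to `L`. -/
def glue (L : AddSubgroup (X d)) (R : Set (X d)) (f h : X d → ℤ) (x : X d) : ℤ :=
  if hx : ∃ r ∈ R, x - r ∈ L then f x + (h hx.choose - f hx.choose) else f x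

section

variable {f h : X d → ℤ}

theorem glue_of_notMem {x : X d} (hx : ∀ y ∈ L, x + y ∉ R) : glue L R f h x = f x := by
  refine dif_neg ?_
  rintro ⟨r, hr, hxr⟩
  exact hx (r - x) (by simpa using L.neg_mem hxr) (by simpa using hr)

theorem IsCollar.glue_apply (hT : IsCollar L R T) (hfh : ∀ p ∈ T, p ∉ R → h p = f p) {p x : X d}
    (hp : p ∈ T) (hxp : x - p ∈ L) : glue L R f h x = f x + (h p - f p) := by
  by_cases hx : ∃ r ∈ R, x - r ∈ L
  · have hchoose : hx.choose = p := by
      refine hT.eq_of_sub_mem _ (hT.subset _ hx.choose_spec.1) p hp ?_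
      simpa only [sub_sub_sub_cancel_left] using L.sub_mem hxp hx.choose_spec.2
    rw [glue, dif_pos hx, hchoose]
  · have hpR : p ∉ R := fun hpR => hx ⟨p, hpR, hxp⟩
    rw [glue, dif_neg hx, hfh p hp hpR, sub_self, add_zero]

theorem IsCollar.glue_add (hT : IsCollar L R T) (hfh : ∀ p ∈ T, p ∉ R → h p = f p) (x : X d)
    {y : X d} (hy : y ∈ L) : glue L R f h (x + y) - f (x + y) = glue L R f h x - f x := by
  by_cases hx : ∃ r ∈ R, x - r ∈ L
  · obtain ⟨r, hr, hxr⟩ := hx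
    have hyr : x + y - r ∈ L := add_sub_right_comm x y r ▸ L.add_mem hxr hy
    rw [hT.glue_apply hfh (hT.subset r hr) hxr, hT.glue_apply hfh (hT.subset r hr) hyr]
    ring
  · have hyx : ¬∃ r ∈ R, x + y - r ∈ L := by
      rintro ⟨r, hr, hyr⟩
      exact hx ⟨r, hr, by simpa [add_sub_right_comm] using L.sub_mem hyr hy⟩
    rw [glue, glue, dif_neg hx, dif_neg hyx, sub_self, sub_self]

end

theorem IsCollar.isHeight_glue (hT : IsCollar L R T) {f h : HeightFunction d}
    (hf : ∀ x, ∀ y ∈ L, f (x + y) - f x = f y - f 0) (hfh : ∀ p ∈ T, p ∉ R → h p = f p) :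
    IsHeight (glue L R f h) := by
  have hstep : ∀ x i, ∀ p ∈ T, p + g i ∈ T → x - p ∈ L →
      glue L R f h (x + g i) - glue L R f h x = h (p + g i) - h p := by
    intro x i p hp hpg hxp
    rw [hT.glue_apply hfh hp hxp, hT.glue_apply hfh hpg (by rwa [add_sub_add_right_eq_sub])]
    have hfp := hf p _ hxp
    have hfpg := hf (p + g i) _ hxp
    rw [add_sub_cancel] at hfp
    rw [add_right_comm, add_sub_cancel] at hfpg
    linarith
  refine ⟨?_, fun x i => ?_⟩
  · rw [hT.glue_apply hfh hT.zero_mem (by simp), add_sub_cancel]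
    exact h.zero_dvd
  by_cases hx : ∃ r ∈ R, x - r ∈ L
  · obtain ⟨r, hr, hxr⟩ := hx
    rw [hstep x i r (hT.subset r hr) (hT.add_mem r hr i) hxr]
    exact h.grad_mem r i
  by_cases hxg : ∃ r ∈ R, x + g i - r ∈ L
  · obtain ⟨r, hr, hxr⟩ := hxg
    rw [hstep x i (r - g i) (hT.sub_mem r hr i) (by simpa using hT.subset r hr)
      (by rwa [sub_sub_eq_add_sub])]
    exact h.grad_mem _ i
  · rw [glue, glue, dif_neg hx, dif_neg hxg]
    exact f.grad_mem x i

theorem IsCollar.exists_glue (hT : IsCollar L R T) {f h : HeightFunction d}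
    (hf : ∀ x, ∀ y ∈ L, f (x + y) - f x = f y - f 0) {c : ℤ}
    (hfh : ∀ p ∈ T, p ∉ R → h p = f p + c) :
    ∃ f' : HeightFunction d, gradientOn T f' = gradientOn T h ∧
      (∀ x, (∀ y ∈ L, x + y ∉ R) → f' x = f x) ∧
      ∀ x, ∀ y ∈ L, f' (x + y) - f (x + y) = f' x - f x := by
  obtain ⟨z, hz, hzR⟩ := hT.exists_notMem
  have hc : ((d : ℤ) + 1) ∣ -c := by
    simpa [hfh z hz hzR] using f.isHeight.dvd_sub h.isHeight z
  have hheight := h.isHeight.add_const hc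
  let h' : HeightFunction d := ⟨fun x => h x + -c, hheight.1, hheight.2⟩
  have hfh' : ∀ p ∈ T, p ∉ R → h' p = f p := fun p hp hpR => by simp [h', hfh p hp hpR]
  have hglue := hT.isHeight_glue hf hfh'
  have hT_apply : ∀ p ∈ T, glue L R f h' p = h p + -c := fun p hp => by
    rw [hT.glue_apply hfh' hp (by simp), add_sub_cancel]
  refine ⟨⟨glue L R f h', hglue.1, hglue.2⟩, gradientOn_eq_iff.mpr fun p hp => ?_,
    fun x hx => glue_of_notMem hx, fun x y hy => hT.glue_add hfh' x hy⟩
  simp [hT_apply p hp, hT_apply 0 hT.zero_mem]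

end Gluing

section DLR

open scoped BigOperators

theorem expect_expect_filter {α : Type*} (Ω : Finset α) {r : α → α → Prop} (hr : Equivalence r)
    [DecidableRel r] (φ : α → ℝ) : 𝔼 a ∈ Ω, 𝔼 b ∈ Ω with r a b, φ b = 𝔼 a ∈ Ω, φ a := by
  let N : α → ℝ := fun a => (Ω.filter (r a)).card
  have hN : ∀ a b, r a b → N a = N b := fun a b hab =>
    congrArg (fun s : Finset α => (s.card : ℝ)) <| Finset.filter_congr fun c _ =>
      ⟨hr.trans (hr.symm hab), hr.trans hab⟩
  have hsymm : ∀ b, ((Ω.filter (r · b)).card : ℝ) = N b := fun b =>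
    congrArg (fun s : Finset α => (s.card : ℝ)) <| Finset.filter_congr fun c _ =>
      ⟨hr.symm, hr.symm⟩
  have hpos : ∀ b ∈ Ω, N b ≠ 0 := fun b hb =>
    Nat.cast_ne_zero.mpr (Finset.card_ne_zero_of_mem (Finset.mem_filter.mpr ⟨hb, hr.refl b⟩))
  rw [Finset.expect_eq_sum_div_card, Finset.expect_eq_sum_div_card]
  congr 1
  calc ∑ a ∈ Ω, 𝔼 b ∈ Ω with r a b, φ b
      = ∑ a ∈ Ω, ∑ b ∈ Ω, if r a b then φ b / N b else 0 := by
        refine Finset.sum_congr rfl fun a _ => ?_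
        rw [Finset.expect_eq_sum_div_card, ← Finset.sum_filter, Finset.sum_div]
        exact Finset.sum_congr rfl fun b hb =>
          congrArg (φ b / ·) (hN a b (Finset.mem_filter.mp hb).2)
    _ = ∑ b ∈ Ω, (Ω.filter (r · b)).card * (φ b / N b) := by
        rw [Finset.sum_comm]
        simp only [← Finset.sum_filter, Finset.sum_const, nsmul_eq_mul]
    _ = ∑ b ∈ Ω, φ b := by
        refine Finset.sum_congr rfl fun b hb => ?_
        rw [hsymm, mul_div_cancel₀ _ (hpos b hb)]

variable {d : ℕ} {L : AddSubgroup (X d)} {s : Module.Dual ℝ (H d)} {R : Set (X d)}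
  {T : Finset (X d)} {A : Set (HeightFunction d)}

theorem finite_of_injOn_gradientOn {S : Set (HeightFunction d)} (hS : S.InjOn (gradientOn T)) :
    S.Finite :=
  ((finite_range_gradientOn T).subset (Set.image_subset_range _ _)).of_finite_image hS

theorem uniformMeasure_apply_eq_of_image_gradientOn_eq {S S' : Set (HeightFunction d)}
    (hS : S.InjOn (gradientOn T)) (hS' : S'.InjOn (gradientOn T))
    (h : gradientOn T '' S = gradientOn T '' S') (hA : IsLocal T (· ∈ A)) :
    uniformMeasure S A = uniformMeasure S' A := by
  have hinter : ∀ S : Set (HeightFunction d),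
      gradientOn T '' (S ∩ A) = gradientOn T '' S ∩ gradientOn T '' A := fun S => by
    refine (Set.image_inter_subset _ _ _).antisymm ?_
    rintro _ ⟨⟨f, hf, rfl⟩, f', hf', hff'⟩
    have hmem : (f' ∈ A) = (f ∈ A) := hA f' f (gradientOn_eq_iff.mp hff')
    exact ⟨f, ⟨hf, hmem ▸ hf'⟩, rfl⟩
  rw [uniformMeasure_apply (finite_of_injOn_gradientOn hS) hA.measurableSet,
    uniformMeasure_apply (finite_of_injOn_gradientOn hS') hA.measurableSet,
    ← hS.ncard_image, ← hS'.ncard_image,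
    ← (hS.mono Set.inter_subset_left).ncard_image,
    ← (hS'.mono Set.inter_subset_left).ncard_image, hinter, hinter, h]

/-- The gradients on `T` of the height functions that differ from `f` by a constant on `T \ R`. -/
def collarGradients (R : Set (X d)) (T : Finset (X d)) (f : HeightFunction d) : Set (T → ℤ) :=
  gradientOn T '' {h | ∃ c, ∀ p ∈ T, p ∉ R → h p = f p + c}

theorem collarGradients_congr {f h : HeightFunction d}
    (hfh : gradientOn T f = gradientOn T h) : collarGradients R T f = collarGradients R T h := by
  have hsub : ∀ {f h : HeightFunction d}, gradientOn T f = gradientOn T h →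
      collarGradients R T f ⊆ collarGradients R T h := by
    rintro f h hfh _ ⟨f', ⟨c, hc⟩, rfl⟩
    refine ⟨f', ⟨f 0 - h 0 + c, fun p hp hpR => ?_⟩, rfl⟩
    have hp' := gradientOn_eq_iff.mp hfh p hp
    rw [hc p hp hpR]
    linarith
  exact (hsub hfh).antisymm (hsub hfh.symm)

theorem IsCollar.injOn_fixedBC (hT : IsCollar L R T) (f : HeightFunction d) :
    (fixedBC R f).InjOn (gradientOn T) := by
  intro h hh h' hh' hgrad
  obtain ⟨z, hz, hzR⟩ := hT.exists_notMem
  rw [gradientOn_eq_iff] at hgrad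
  have hgradz := hgrad z hz
  rw [hh z hzR, hh' z hzR, sub_right_inj] at hgradz
  ext x
  by_cases hx : x ∈ R
  · simpa [hgradz] using hgrad x (hT.subset x hx)
  · rw [hh x hx, hh' x hx]

theorem IsCollar.image_fixedBC (hT : IsCollar L R T) (f : HeightFunction d) :
    gradientOn T '' fixedBC R f = collarGradients R T f := by
  refine Set.Subset.antisymm (Set.image_mono fun h hh => ⟨0, fun p _ hpR => by simp [hh p hpR]⟩) ?_
  rintro _ ⟨h, ⟨c, hc⟩, rfl⟩
  obtain ⟨f', hf'T, hf'R, -⟩ := hT.bot.exists_glue (f := f) (by simp) hc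
  exact ⟨f', fun x hx => hf'R x (by simpa using hx), hf'T⟩

theorem IsCollar.isLocal_uniformMeasure_fixedBC (hT : IsCollar L R T) (hA : IsLocal T (· ∈ A)) :
    IsLocal T fun f => uniformMeasure (fixedBC R f) A := by
  intro f h hfh
  refine uniformMeasure_apply_eq_of_image_gradientOn_eq (hT.injOn_fixedBC f) (hT.injOn_fixedBC h)
    ?_ hA
  rw [hT.image_fixedBC, hT.image_fixedBC, collarGradients_congr (gradientOn_eq_iff.mpr hfh)]

/-- The periodic height functions that have the same gradient as `f` off the translates of `R`
by `L`: the periodic counterpart of `fixedBC R f`. -/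
def periodicFixedBC (L : AddSubgroup (X d)) (s : Module.Dual ℝ (H d)) (R : Set (X d))
    (f : HeightFunction d) : Set (HeightFunction d) :=
  {h ∈ periodicBC L s | ∃ c, ∀ x, (∀ y ∈ L, x + y ∉ R) → h x = f x + c}

theorem add_sub_of_mem_periodicBC {f : HeightFunction d} (hf : f ∈ periodicBC L s) (x : X d)
    {y : X d} (hy : y ∈ L) : ((f (x + y) - f x : ℤ) : ℝ) = s (embed d y) := by
  rw [Int.cast_sub, hf.2 x y hy, add_sub_cancel_left]

theorem IsCollar.injOn_periodicFixedBC (hT : IsCollar L R T) (f : HeightFunction d) :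
    (periodicFixedBC L s R f).InjOn (gradientOn T) := by
  rintro h ⟨hh, c, hc⟩ h' ⟨hh', c', hc'⟩ hgrad
  have heq : ∀ p ∈ T, h p = h' p := fun p hp => by
    simpa [hh.1, hh'.1] using gradientOn_eq_iff.mp hgrad p hp
  obtain ⟨z, hz, hzR⟩ := hT.exists_notMem
  have hcc' : c = c' := by
    have hzz := heq z hz
    rwa [hc z (hT.add_notMem hz hzR), hc' z (hT.add_notMem hz hzR), add_right_inj] at hzz
  ext x
  by_cases hx : ∀ y ∈ L, x + y ∉ R
  · rw [hc x hx, hc' x hx, hcc']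
  · push Not at hx
    obtain ⟨y, hy, hxy⟩ := hx
    have hdiff : h (x + y) - h x = h' (x + y) - h' x := by
      exact_mod_cast (add_sub_of_mem_periodicBC hh x hy).trans
        (add_sub_of_mem_periodicBC hh' x hy).symm
    linarith [heq _ (hT.subset _ hxy)]

theorem IsCollar.image_periodicFixedBC (hT : IsCollar L R T) {f : HeightFunction d}
    (hf : f ∈ periodicBC L s) :
    gradientOn T '' periodicFixedBC L s R f = collarGradients R T f := by
  refine Set.Subset.antisymm (Set.image_mono fun h hh => ?_) ?_
  · obtain ⟨c, hc⟩ := hh.2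
    exact ⟨c, fun p hp hpR => hc p (hT.add_notMem hp hpR)⟩
  rintro _ ⟨h, ⟨c, hc⟩, rfl⟩
  have hgrad : ∀ x, ∀ y ∈ L, f (x + y) - f x = f y - f 0 := fun x y hy => by
    have h0 := add_sub_of_mem_periodicBC hf 0 hy
    rw [zero_add] at h0
    exact_mod_cast (add_sub_of_mem_periodicBC hf x hy).trans h0.symm
  obtain ⟨f', hf'T, hf'R, hf'L⟩ := hT.exists_glue hgrad hc
  refine ⟨normalize f', ⟨⟨by simp [normalize], fun x y hy => ?_⟩, -f' 0, fun x hx => ?_⟩, ?_⟩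
  · have hsub : f' (x + y) = f' x + (f (x + y) - f x) := by linarith [hf'L x y hy]
    simp only [normalize, hsub, Int.cast_sub (_ + _), Int.cast_add,
      add_sub_of_mem_periodicBC hf x hy]
    push_cast
    ring
  · simp [normalize, hf'R x hx, sub_eq_add_neg]
  · simpa [gradientOn, normalize, funext_iff] using congrFun hf'T

theorem IsCollar.uniformMeasure_periodicFixedBC (hT : IsCollar L R T) {f : HeightFunction d}
    (hf : f ∈ periodicBC L s) (hA : IsLocal T (· ∈ A)) :
    uniformMeasure (periodicFixedBC L s R f) A = uniformMeasure (fixedBC R f) A :=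
  uniformMeasure_apply_eq_of_image_gradientOn_eq (hT.injOn_periodicFixedBC f)
    (hT.injOn_fixedBC f) ((hT.image_periodicFixedBC hf).trans (hT.image_fixedBC f).symm) hA

theorem real_uniformMeasure {S : Set (HeightFunction d)} (hS : S.Finite) (hA : MeasurableSet A) :
    (uniformMeasure S).real A = 𝔼 f ∈ hS.toFinset, A.indicator 1 f := by
  rw [← integral_uniformMeasure hS (measurable_one.indicator hA), integral_indicator_one hA]

theorem IsCollar.integral_uniformMeasure_fixedBC [L.FiniteIndex] (hT : IsCollar L R T)
    (hA : IsLocal T (· ∈ A)) :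
    ∫ f, (uniformMeasure (fixedBC R f)).real A ∂(uniformMeasure (periodicBC L s)) =
      (uniformMeasure (periodicBC L s)).real A := by
  classical
  have hΩ : (periodicBC L s).Finite := finite_periodicBC
  let r : HeightFunction d → HeightFunction d → Prop := fun f h =>
    ∃ c, ∀ x, (∀ y ∈ L, x + y ∉ R) → h x = f x + c
  have hr : Equivalence r :=
    ⟨fun f => ⟨0, fun x _ => (add_zero _).symm⟩,
      fun ⟨c, hc⟩ => ⟨-c, fun x hx => by rw [hc x hx, add_neg_cancel_right]⟩,
      fun ⟨c, hc⟩ ⟨c', hc'⟩ => ⟨c + c', fun x hx => by rw [hc' x hx, hc x hx, add_assoc]⟩⟩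
  have hclass : ∀ f ∈ hΩ.toFinset, (uniformMeasure (fixedBC R f)).real A =
      𝔼 h ∈ hΩ.toFinset with r f h, A.indicator 1 h := by
    intro f hf
    have hfin : (periodicFixedBC L s R f).Finite := hΩ.subset fun h hh => hh.1
    have htoFinset : hfin.toFinset = {h ∈ hΩ.toFinset | r f h} := by
      ext h
      simp [periodicFixedBC, r]
    rw [Measure.real, ← hT.uniformMeasure_periodicFixedBC (hΩ.mem_toFinset.mp hf) hA,
      ← Measure.real, real_uniformMeasure hfin hA.measurableSet, htoFinset]
  have hmeas : Measurable fun f => (uniformMeasure (fixedBC R f)).real A :=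
    (hT.isLocal_uniformMeasure_fixedBC hA).measurable.ennreal_toReal
  rw [integral_uniformMeasure hΩ hmeas, Finset.expect_congr rfl hclass,
    expect_expect_filter _ hr, real_uniformMeasure hΩ hA.measurableSet]

end DLR

section Gibbs

variable {d : ℕ} [Infinite (X d)] {R : Set (X d)}

theorem isProbabilityMeasure_uniformMeasure_fixedBC (hR : R.Finite) (f : HeightFunction d) :
    IsProbabilityMeasure (uniformMeasure (fixedBC R f)) := by
  obtain ⟨T, -, hT⟩ := exists_isCollar_bot hR ∅
  exact isProbabilityMeasure_uniformMeasure (finite_of_injOn_gradientOn (hT.injOn_fixedBC f))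
    ⟨f, fun _ _ => rfl⟩

theorem measurable_uniformMeasure_fixedBC (hR : R.Finite) :
    Measurable fun f : HeightFunction d => uniformMeasure (fixedBC R f) := by
  have := isProbabilityMeasure_uniformMeasure_fixedBC hR
  refine Measurable.measure_of_isPiSystem_of_isProbabilityMeasure
    gradientField_eq_generateFrom_localEvents isPiSystem_localEvents ?_
  rintro A ⟨T₀, hA⟩
  obtain ⟨T, hT₀, hT⟩ := exists_isCollar_bot hR T₀
  exact (hT.isLocal_uniformMeasure_fixedBC (hA.mono hT₀)).measurable

theorem isGradientGibbs_of_isLocal {μ : Measure (HeightFunction d)} [IsProbabilityMeasure μ]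
    (h : ∀ (R : Set (X d)) (T : Finset (X d)) (A : Set (HeightFunction d)), IsCollar ⊥ R T →
      IsLocal T (· ∈ A) → ∫ f, (uniformMeasure (fixedBC R f)).real A ∂μ = μ.real A) :
    IsGradientGibbs μ := by
  intro R hR A hA
  have hprob := isProbabilityMeasure_uniformMeasure_fixedBC hR
  have hmeas := measurable_uniformMeasure_fixedBC hR
  have hbind : IsProbabilityMeasure (μ.bind fun f => uniformMeasure (fixedBC R f)) :=
    isProbabilityMeasure_bind hmeas.aemeasurable (Eventually.of_forall hprob)
  have heq : μ.bind (fun f => uniformMeasure (fixedBC R f)) = μ := by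
    refine ext_of_isLocal fun T₀ B hB => ?_
    obtain ⟨T, hT₀, hT⟩ := exists_isCollar_bot hR T₀
    rw [← ENNReal.toReal_eq_toReal_iff' (measure_ne_top _ _) (measure_ne_top _ _),
      Measure.bind_apply hB.measurableSet hmeas.aemeasurable, ← measureReal_def μ,
      ← h R T B hT (hB.mono hT₀)]
    exact (integral_toReal ((Measure.measurable_coe hB.measurableSet).comp hmeas).aemeasurable
      (Eventually.of_forall fun f => measure_lt_top _ _)).symm
  conv_lhs => rw [← heq]
  exact Measure.bind_apply hA hmeas.aemeasurable

variable {L : ℕ → AddSubgroup (X d)} [∀ j, (L j).FiniteIndex] {t : ℕ → Module.Dual ℝ (H d)}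
  {μ : Measure (HeightFunction d)} [IsProbabilityMeasure μ]

theorem IsLocalLimit.isGradientGibbs
    (h : IsLocalLimit (fun j => uniformMeasure (periodicBC (L j) (t j))) μ)
    (hL : ∀ x ≠ 0, ∀ᶠ j in atTop, x ∉ L j) : IsGradientGibbs μ := by
  refine isGradientGibbs_of_isLocal fun R T A hT hA => ?_
  have hlocal : IsLocal T fun f => (uniformMeasure (fixedBC R f)).real A := fun f f' hff' =>
    congrArg ENNReal.toReal (hT.isLocal_uniformMeasure_fixedBC hA f f' hff')
  refine tendsto_nhds_unique ((h T _ hlocal).congr' ?_) (h.tendsto_measureReal hA)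
  filter_upwards [hT.eventually hL] with j hTj
  exact hTj.integral_uniformMeasure_fixedBC hA

end Gibbs

section Slopes

variable {d : ℕ}

/-- The linear functional `v ↦ ∑ i, a i * v i` on the hyperplane `H`. -/
def coeffDual (a : Fin (d + 1) → ℝ) : Module.Dual ℝ (H d) :=
  (∑ i, a i • LinearMap.proj i) ∘ₗ (H d).subtype

theorem coeffDual_apply (a : Fin (d + 1) → ℝ) (v : H d) :
    coeffDual a v = ∑ i, a i * (v : Fin (d + 1) → ℝ) i := by
  simp [coeffDual]

theorem embed_g_apply (i j : Fin (d + 1)) :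
    (embed d (g i) : Fin (d + 1) → ℝ) j = (if j = i then 1 else 0) - 1 / ((d : ℝ) + 1) := by
  change ((Pi.single i (1 : ℤ) : Fin (d + 1) → ℤ) j : ℝ) -
    (∑ k, ((Pi.single i (1 : ℤ) : Fin (d + 1) → ℤ) k : ℝ)) / (d + 1) = _
  rw [← Int.cast_sum, Finset.sum_pi_single', Pi.single_apply]
  simp

theorem coeffDual_embed_g {a : Fin (d + 1) → ℝ} (ha : ∑ i, a i = 0) (i : Fin (d + 1)) :
    coeffDual a (embed d (g i)) = a i := by
  simp only [coeffDual_apply, embed_g_apply, mul_sub, Finset.sum_sub_distrib, ← Finset.sum_mul, ha]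
  simp

theorem sum_smul_embed_g (v : H d) : ∑ i, (v : Fin (d + 1) → ℝ) i • embed d (g i) = v := by
  ext j
  have hv : ∑ i, (v : Fin (d + 1) → ℝ) i = 0 := v.2
  rw [Submodule.coe_sum, Finset.sum_apply]
  simp only [Submodule.coe_smul, Pi.smul_apply, smul_eq_mul, embed_g_apply, mul_sub,
    Finset.sum_sub_distrib, ← Finset.sum_mul, hv]
  simp

theorem coeffDual_slope (s : Module.Dual ℝ (H d)) :
    coeffDual (fun i => s (embed d (g i))) = s := by
  ext v
  conv_rhs => rw [← sum_smul_embed_g v, map_sum]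
  simp only [coeffDual_apply, map_smul, smul_eq_mul, mul_comm]

theorem slope_zero_eq_neg_sum (s : Module.Dual ℝ (H d)) :
    s (embed d (g 0)) = -∑ j : Fin d, s (embed d (g j.succ)) :=
  eq_neg_of_add_eq_zero_left (Fin.sum_univ_succ (fun i => s (embed d (g i))) ▸ sum_slope_eq_zero s)

/-- The values of `n s` on the generators, rounded up on all but `g 0` and adjusted there so that
the sum is zero. Rounding up makes the value on `g 0` smaller, so the result is still a Lipschitz
slope after division by `n`. -/
def approxCoeff (s : Module.Dual ℝ (H d)) (n : ℕ) : Fin (d + 1) → ℤ :=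
  Fin.cons (-∑ j : Fin d, ⌈n * s (embed d (g j.succ))⌉) fun j => ⌈n * s (embed d (g j.succ))⌉

theorem sum_approxCoeff (s : Module.Dual ℝ (H d)) (n : ℕ) : ∑ i, approxCoeff s n i = 0 := by
  simp [Fin.sum_univ_succ, approxCoeff]

theorem approxCoeff_le {s : Module.Dual ℝ (H d)} (hs : s ∈ slopes d) (n : ℕ) (i : Fin (d + 1)) :
    approxCoeff s n i ≤ n := by
  have hmul_le : ∀ i, n * s (embed d (g i)) ≤ n := fun i =>
    mul_le_of_le_one_right n.cast_nonneg (hs i)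
  refine Fin.cases ?_ (fun j => ?_) i
  · have hceil : (n : ℝ) * ∑ j : Fin d, s (embed d (g j.succ)) ≤
        ∑ j : Fin d, (⌈n * s (embed d (g j.succ))⌉ : ℝ) := by
      rw [Finset.mul_sum]
      exact Finset.sum_le_sum fun j _ => Int.le_ceil _
    have hzero := hmul_le 0
    rw [slope_zero_eq_neg_sum] at hzero
    rw [approxCoeff, Fin.cons_zero, ← Int.cast_le (R := ℝ)]
    push_cast
    linarith
  · rw [approxCoeff, Fin.cons_succ, Int.ceil_le]
    exact_mod_cast hmul_le j.succ

/-- The slope in `slopesN d n` that approximates `s`. -/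
def approxSlope (s : Module.Dual ℝ (H d)) (n : ℕ) : Module.Dual ℝ (H d) :=
  coeffDual fun i => (approxCoeff s n i : ℝ) / n

theorem approxSlope_embed_g (s : Module.Dual ℝ (H d)) (n : ℕ) (i : Fin (d + 1)) :
    approxSlope s n (embed d (g i)) = (approxCoeff s n i : ℝ) / n := by
  refine coeffDual_embed_g ?_ i
  rw [← Finset.sum_div, ← Int.cast_sum, sum_approxCoeff, Int.cast_zero, zero_div]

theorem approxSlope_mem_slopesN {s : Module.Dual ℝ (H d)} (hs : s ∈ slopes d) (n : ℕ) :
    approxSlope s n ∈ slopesN d n := by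
  refine ⟨fun i => ?_, fun i => ⟨_, approxSlope_embed_g s n i⟩⟩
  rw [approxSlope_embed_g]
  exact div_le_one_of_le₀ (by exact_mod_cast approxCoeff_le hs n i) n.cast_nonneg

theorem tendsto_ceil_natCast_mul_div_atTop (a : ℝ) :
    Tendsto (fun n : ℕ => (⌈n * a⌉ : ℝ) / n) atTop (𝓝 a) := by
  have hupper : Tendsto (fun n : ℕ => a + 1 / (n : ℝ)) atTop (𝓝 a) := by
    simpa using tendsto_const_nhds.add (tendsto_one_div_atTop_nhds_zero_nat (𝕜 := ℝ))
  refine tendsto_of_tendsto_of_tendsto_of_le_of_le' tendsto_const_nhds hupper ?_ ?_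
  · filter_upwards [eventually_gt_atTop 0] with n hn
    rw [le_div_iff₀ (Nat.cast_pos.mpr hn), mul_comm]
    exact Int.le_ceil _
  · filter_upwards [eventually_gt_atTop 0] with n hn
    have hn' : (n : ℝ) ≠ 0 := Nat.cast_ne_zero.mpr hn.ne'
    rw [div_le_iff₀ (Nat.cast_pos.mpr hn), add_mul, one_div_mul_cancel hn', mul_comm a]
    exact (Int.ceil_lt_add_one _).le

theorem tendsto_approxCoeff_div (s : Module.Dual ℝ (H d)) (i : Fin (d + 1)) :
    Tendsto (fun n => (approxCoeff s n i : ℝ) / n) atTop (𝓝 (s (embed d (g i)))) := by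
  refine Fin.cases ?_ (fun j => ?_) i
  · rw [slope_zero_eq_neg_sum]
    simp only [approxCoeff, Fin.cons_zero, Int.cast_neg, Int.cast_sum, neg_div, Finset.sum_div]
    exact (tendsto_finsetSum _ fun j _ => tendsto_ceil_natCast_mul_div_atTop _).neg
  · simp only [approxCoeff, Fin.cons_succ]
    exact tendsto_ceil_natCast_mul_div_atTop _

theorem tendsto_approxSlope (s : Module.Dual ℝ (H d)) (v : H d) :
    Tendsto (fun n => approxSlope s n v) atTop (𝓝 (s v)) := by
  conv => rhs; rw [← coeffDual_slope s]
  simp only [approxSlope, coeffDual_apply]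
  exact tendsto_finsetSum _ fun i _ => (tendsto_approxCoeff_div s i).mul_const _

end Slopes

section SubGaussian

open ProbabilityTheory

theorem one_add_sq_div_two_le_cosh (x : ℝ) : 1 + x ^ 2 / 2 ≤ Real.cosh x := by
  have hsinh : (x / 2) ^ 2 ≤ Real.sinh (x / 2) ^ 2 := by
    rw [sq_le_sq, Real.abs_sinh]
    exact Real.self_le_sinh_iff.mpr (abs_nonneg _)
  calc 1 + x ^ 2 / 2 = 1 + 2 * (x / 2) ^ 2 := by ring
    _ ≤ 1 + 2 * Real.sinh (x / 2) ^ 2 := by gcongr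
    _ = Real.cosh (2 * (x / 2)) := by rw [Real.cosh_two_mul, Real.cosh_sq]; ring
    _ = Real.cosh x := by rw [mul_div_cancel₀ x two_ne_zero]

theorem le_of_forall_one_add_mul_le_exp_mul {a b : ℝ}
    (h : ∀ u, 0 < u → 1 + a * u ≤ Real.exp (b * u)) : a ≤ b := by
  have hderiv : HasDerivAt (fun u => Real.exp (b * u)) b 0 := by
    simpa using ((hasDerivAt_id (0 : ℝ)).const_mul b).exp
  refine ge_of_tendsto hderiv.tendsto_slope_zero_right ?_
  filter_upwards [self_mem_nhdsWithin] with u (hu : 0 < u)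
  rw [zero_add, mul_zero, Real.exp_zero, smul_eq_mul, ← div_eq_inv_mul, le_div_iff₀ hu]
  linarith [h u hu]

variable {Ω : Type*} [MeasurableSpace Ω] {μ : Measure Ω} {Y : Ω → ℝ} {r c : NNReal}

theorem measureReal_mul_le_le_of_hasSubgaussianMGF (h : HasSubgaussianMGF Y (r ^ 2 * c) μ)
    (hr : r ≠ 0) {a : ℝ} (ha : 0 ≤ a) :
    μ.real {ω | r * a ≤ Y ω} ≤ Real.exp (-(a ^ 2 / (2 * c))) := by
  have hr2 : (r : ℝ) ^ 2 ≠ 0 := by positivity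
  refine (h.measure_ge_le (mul_nonneg r.coe_nonneg ha)).trans_eq ?_
  push_cast
  rw [neg_div, mul_pow, mul_left_comm, mul_div_mul_left _ _ hr2]

theorem measureReal_le_mul_le_of_hasSubgaussianMGF (h : HasSubgaussianMGF Y (r ^ 2 * c) μ)
    (hr : r ≠ 0) {a : ℝ} (ha : a ≤ 0) :
    μ.real {ω | Y ω ≤ r * a} ≤ Real.exp (-(a ^ 2 / (2 * c))) := by
  simpa only [Pi.neg_apply, mul_neg, neg_le_neg_iff, neg_sq] using
    measureReal_mul_le_le_of_hasSubgaussianMGF h.neg hr (neg_nonneg.mpr ha)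

variable [IsProbabilityMeasure μ]

theorem one_add_integral_sq_mul_le_exp (h : HasSubgaussianMGF Y c μ) (l : ℝ) :
    1 + (∫ ω, Y ω ^ 2 ∂μ) / 2 * l ^ 2 ≤ Real.exp (c / 2 * l ^ 2) := by
  have hsq : Integrable (fun ω => Y ω ^ 2 / 2 * l ^ 2) μ :=
    ((h.memLp 2).integrable_sq.div_const _).mul_const _
  have hcosh : Integrable (fun ω => Real.cosh (l * Y ω)) μ := by
    simpa only [Real.cosh_eq, neg_mul, Pi.add_apply] using
      ((h.integrable_exp_mul l).add (h.integrable_exp_mul (-l))).div_const 2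
  calc 1 + (∫ ω, Y ω ^ 2 ∂μ) / 2 * l ^ 2
      = ∫ ω, (1 + Y ω ^ 2 / 2 * l ^ 2) ∂μ := by
        rw [integral_add (integrable_const _) hsq, integral_mul_const, integral_div]
        simp
    _ ≤ ∫ ω, Real.cosh (l * Y ω) ∂μ := by
        refine integral_mono ((integrable_const _).add hsq) hcosh fun ω => ?_
        refine le_of_eq_of_le ?_ (one_add_sq_div_two_le_cosh (l * Y ω))
        ring
    _ = (mgf Y μ l + mgf Y μ (-l)) / 2 := by
        simp only [Real.cosh_eq, ← neg_mul]
        rw [integral_div,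
          integral_add (h.integrable_exp_mul l) (h.integrable_exp_mul (-l)), mgf, mgf]
    _ ≤ (Real.exp (c * l ^ 2 / 2) + Real.exp (c * (-l) ^ 2 / 2)) / 2 := by
        gcongr
        · exact h.mgf_le l
        · exact h.mgf_le (-l)
    _ = Real.exp (c / 2 * l ^ 2) := by ring_nf

theorem variance_le_of_hasSubgaussianMGF (h : HasSubgaussianMGF Y c μ) : Var[Y; μ] ≤ c := by
  refine (variance_le_expectation_sq h.aestronglyMeasurable).trans ?_
  suffices hhalf : (∫ ω, Y ω ^ 2 ∂μ) / 2 ≤ c / 2 from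
    (div_le_div_iff_of_pos_right two_pos).mp hhalf
  refine le_of_forall_one_add_mul_le_exp_mul fun u hu => ?_
  simpa only [Real.sq_sqrt hu.le] using one_add_integral_sq_mul_le_exp h √u

end SubGaussian

section Limits

open ProbabilityTheory

variable {d : ℕ}

theorem isLocal_comp_sub {β : Type*} (x y : X d) (φ : ℤ → β) :
    IsLocal {x, y} fun f : HeightFunction d => φ (f y - f x) := by
  intro f h hfh
  have hx := hfh x (by simp)
  have hy := hfh y (by simp)
  exact congrArg φ (by linarith)

theorem IsLocal.exists_comp_shift {β : Type*} {R : Finset (X d)} {F : HeightFunction d → β}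
    (hF : IsLocal R F) (v : X d) : ∃ R' : Finset (X d), IsLocal R' (F ∘ shift v) := by
  classical
  refine ⟨insert v (R.image (· + v)), fun f h hfh => hF _ _ fun x hx => ?_⟩
  have hv := hfh v (by simp)
  have hxv := hfh (x + v) (Finset.mem_insert_of_mem (Finset.mem_image_of_mem _ hx))
  simp only [shift, zero_add]
  linarith

section Periodic

variable {L : AddSubgroup (X d)} [L.FiniteIndex] {s : Module.Dual ℝ (H d)}

theorem isShiftInvariant_uniformMeasure_periodicBC :
    IsShiftInvariant (uniformMeasure (periodicBC L s)) := by
  intro v A hA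
  rw [image_shift, uniformMeasure_apply finite_periodicBC (measurable_shift (-v) hA),
    uniformMeasure_apply finite_periodicBC hA]
  congr 2
  conv_lhs => rw [← shift_preimage_periodicBC (-v), ← Set.preimage_inter]
  exact Set.ncard_preimage_of_injective_subset_range (shift_injective _) fun f _ =>
    ⟨shift v f, shift_neg_shift v f⟩

theorem hasSlope_uniformMeasure_periodicBC (hne : (periodicBC L s).Nonempty) :
    HasSlope (uniformMeasure (periodicBC L s)) s := by
  intro x
  have hlocal : IsLocal {0, x} fun f : HeightFunction d => (f x : ℝ) - f 0 := by
    simpa only [Int.cast_sub] using isLocal_comp_sub 0 x (Int.cast : ℤ → ℝ)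
  rw [integral_uniformMeasure finite_periodicBC hlocal.measurable, ← expect_periodicBC hne]
  refine Finset.expect_congr rfl fun f hf => ?_
  rw [(finite_periodicBC.mem_toFinset.mp hf).1, Int.cast_zero, sub_zero]

end Periodic

/-- The height difference between two vertices at distance `n`, centered by the slope `s`, is
sub-Gaussian with variance proxy `(d + 1) ^ 2 * n`. -/
def HasSubgaussianIncrements (μ : Measure (HeightFunction d)) (s : Module.Dual ℝ (H d)) : Prop :=
  ∀ x y : X d, HasSubgaussianMGF (fun f => (f y : ℝ) - f x - s (embed d (y - x)))
    (((d : NNReal) + 1) ^ 2 * (graph d).dist x y) μ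

theorem isLocal_exp_mul_sub (x y : X d) (l b : ℝ) :
    IsLocal {x, y} fun f : HeightFunction d => Real.exp (l * ((f y : ℝ) - f x - b)) := by
  simpa only [Int.cast_sub] using isLocal_comp_sub x y fun k : ℤ => Real.exp (l * (k - b))

theorem hasSubgaussianIncrements_uniformMeasure_periodicBC {L : AddSubgroup (X d)} [L.FiniteIndex]
    {s : Module.Dual ℝ (H d)} (hne : (periodicBC L s).Nonempty) :
    HasSubgaussianIncrements (uniformMeasure (periodicBC L s)) s := by
  have := isProbabilityMeasure_uniformMeasure finite_periodicBC hne
  refine fun x y => ⟨fun l => (isLocal_exp_mul_sub x y l _).integrable _, fun l => ?_⟩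
  rw [mgf, integral_uniformMeasure finite_periodicBC (isLocal_exp_mul_sub x y l _).measurable]
  refine (expect_exp_periodicBC_le hne x y l).trans_eq ?_
  rw [← Real.exp_nat_mul]
  congr 1
  push_cast
  ring

namespace HasSubgaussianIncrements

variable {μ : Measure (HeightFunction d)} {s : Module.Dual ℝ (H d)}

theorem variance_le [IsProbabilityMeasure μ] (h : HasSubgaussianIncrements μ s) (x y : X d) :
    Var[fun f : HeightFunction d => (f y : ℝ) - f x; μ] ≤
      ((d : ℝ) + 1) ^ 2 * (graph d).dist x y := by
  have hmeas : Measurable fun f : HeightFunction d => (f y : ℝ) - f x := by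
    simpa only [Int.cast_sub] using (isLocal_comp_sub x y (Int.cast : ℤ → ℝ)).measurable
  rw [← variance_sub_const hmeas.aestronglyMeasurable (s (embed d (y - x)))]
  exact_mod_cast variance_le_of_hasSubgaussianMGF (h x y)

theorem upper_tail_le (h : HasSubgaussianIncrements μ s) (x y : X d) {a : ℝ} (ha : 0 ≤ a) :
    μ.real {f | (f y : ℝ) - f x - s (embed d (y - x)) ≥ ((d : ℝ) + 1) * a} ≤
      Real.exp (-(a ^ 2 / (2 * (graph d).dist x y))) := by
  exact_mod_cast measureReal_mul_le_le_of_hasSubgaussianMGF (h x y) (by positivity) ha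

theorem lower_tail_le (h : HasSubgaussianIncrements μ s) (x y : X d) {a : ℝ} (ha : a ≤ 0) :
    μ.real {f | (f y : ℝ) - f x - s (embed d (y - x)) ≤ ((d : ℝ) + 1) * a} ≤
      Real.exp (-(a ^ 2 / (2 * (graph d).dist x y))) := by
  exact_mod_cast measureReal_le_mul_le_of_hasSubgaussianMGF (h x y) (by positivity) ha

end HasSubgaussianIncrements

namespace IsLocalLimit

variable {ν : ℕ → Measure (HeightFunction d)} {μ : Measure (HeightFunction d)}

theorem isShiftInvariant [∀ j, IsFiniteMeasure (ν j)] [IsProbabilityMeasure μ]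
    (h : IsLocalLimit ν μ) (hν : ∀ j, IsShiftInvariant (ν j)) : IsShiftInvariant μ := by
  intro v A hA
  have hmeas := measurable_shift (d := d) (-v)
  have hprob : IsProbabilityMeasure (μ.map (shift (-v))) :=
    Measure.isProbabilityMeasure_map hmeas.aemeasurable
  have heq : μ.map (shift (-v)) = μ := by
    refine ext_of_isLocal fun R B hB => ?_
    obtain ⟨R', hR'⟩ := hB.exists_comp_shift (-v)
    rw [Measure.map_apply hmeas hB.measurableSet]
    refine tendsto_nhds_unique (h.tendsto_measure hR') ((h.tendsto_measure hB).congr fun j => ?_)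
    exact (image_shift v B ▸ hν j v B hB.measurableSet).symm
  rw [image_shift, ← Measure.map_apply hmeas hA, heq]

variable {t : ℕ → Module.Dual ℝ (H d)} {s : Module.Dual ℝ (H d)}

theorem hasSlope (h : IsLocalLimit ν μ) (hν : ∀ j, HasSlope (ν j) (t j))
    (ht : ∀ v, Tendsto (fun j => t j v) atTop (𝓝 (s v))) : HasSlope μ s := by
  intro x
  have hlocal : IsLocal {0, x} fun f : HeightFunction d => (f x : ℝ) - f 0 := by
    simpa only [Int.cast_sub] using isLocal_comp_sub 0 x (Int.cast : ℤ → ℝ)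
  refine tendsto_nhds_unique (h _ _ hlocal) ?_
  simpa only [hν _ x] using ht (embed d x)

theorem hasSubgaussianMGF [IsFiniteMeasure μ] (h : IsLocalLimit ν μ) {x y : X d} {a : ℕ → ℝ}
    {b : ℝ} {c : NNReal} (ha : Tendsto a atTop (𝓝 b))
    (hν : ∀ j, HasSubgaussianMGF (fun f : HeightFunction d => (f y : ℝ) - f x - a j) c (ν j)) :
    HasSubgaussianMGF (fun f : HeightFunction d => (f y : ℝ) - f x - b) c μ := by
  refine ⟨fun l => (isLocal_exp_mul_sub x y l b).integrable μ, fun l => ?_⟩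
  have hle : ∀ j, ∫ f, Real.exp (l * ((f y : ℝ) - f x - b)) ∂(ν j) ≤
      Real.exp (l * (a j - b)) * Real.exp (c * l ^ 2 / 2) := by
    intro j
    calc ∫ f, Real.exp (l * ((f y : ℝ) - f x - b)) ∂(ν j)
        = Real.exp (l * (a j - b)) * mgf (fun f => (f y : ℝ) - f x - a j) (ν j) l := by
          rw [mgf, ← integral_const_mul]
          congr 1 with f
          rw [← Real.exp_add]
          ring_nf
      _ ≤ _ := by gcongr; exact (hν j).mgf_le l
  have hbound : Tendsto (fun j => Real.exp (l * (a j - b)) * Real.exp (c * l ^ 2 / 2)) atTop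
      (𝓝 (Real.exp (c * l ^ 2 / 2))) := by
    simpa using ((ha.sub_const b).const_mul l).rexp.mul_const (Real.exp (c * l ^ 2 / 2))
  exact le_of_tendsto_of_tendsto' (h _ _ (isLocal_exp_mul_sub x y l b)) hbound hle

theorem hasSubgaussianIncrements [IsFiniteMeasure μ] (h : IsLocalLimit ν μ)
    (hν : ∀ j, HasSubgaussianIncrements (ν j) (t j))
    (ht : ∀ v, Tendsto (fun j => t j v) atTop (𝓝 (s v))) : HasSubgaussianIncrements μ s :=
  fun x y => h.hasSubgaussianMGF (ht _) fun j => hν j x y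

end IsLocalLimit

end Limits

end SimplicialLattice

end

theorem mainTheorem7_general (d : ℕ) (hd : 1 ≤ d) (s : Module.Dual ℝ (H d)) (hs : s ∈ slopes d) :
    ∃ μ : Measure (HeightFunction d),
      IsProbabilityMeasure μ ∧ IsShiftInvariant μ ∧ IsGradientGibbs μ ∧ HasSlope μ s ∧
      (∀ x y : X d,
        ProbabilityTheory.variance (fun f : HeightFunction d => (f y : ℝ) - (f x : ℝ)) μ
          ≤ ((d : ℝ) + 1) ^ 2 * ((graph d).dist x y : ℝ)) ∧
      (∀ x y : X d, 0 < (graph d).dist x y → ∀ a : ℝ, 0 ≤ a →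
        μ.real {f | (f y : ℝ) - (f x : ℝ) - s (embed d (y - x)) ≥ ((d : ℝ) + 1) * a}
          ≤ Real.exp (-(a ^ 2 / (2 * ((graph d).dist x y : ℝ))))) ∧
      (∀ x y : X d, 0 < (graph d).dist x y → ∀ a : ℝ, a ≤ 0 →
        μ.real {f | (f y : ℝ) - (f x : ℝ) - s (embed d (y - x)) ≤ ((d : ℝ) + 1) * a}
          ≤ Real.exp (-(a ^ 2 / (2 * ((graph d).dist x y : ℝ))))) ∧
      (∃ (t : ℕ → Module.Dual ℝ (H d)) (k : ℕ → ℕ),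
        (∀ n, 0 < n → t n ∈ slopesN d n) ∧
        (∀ v : H d, Tendsto (fun n => t n v) atTop (𝓝 (s v))) ∧
        StrictMono k ∧ (∀ j, 0 < k j) ∧
        LocallyConverges
          (fun j => uniformMeasure (periodicBC (latticeN d (k j)) (t (k j)))) μ) := by
  have hinf := infinite_lattice hd
  have hne := fun n => nonempty_periodicBC (approxSlope_mem_slopesN hs (n + 1))
  have hprob := fun n => isProbabilityMeasure_uniformMeasure finite_periodicBC (hne n)
  obtain ⟨μ, hμ, k, hk, hlim⟩ := exists_isLocalLimit_subseq fun n =>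
    uniformMeasure (periodicBC (latticeN d (n + 1)) (approxSlope s (n + 1)))
  have hk1 : StrictMono fun j => k j + 1 := fun _ _ hij => Nat.succ_lt_succ (hk hij)
  have hslopes : ∀ v, Tendsto (fun j => approxSlope s (k j + 1) v) atTop (𝓝 (s v)) :=
    fun v => (tendsto_approxSlope s v).comp hk1.tendsto_atTop
  have hsub : HasSubgaussianIncrements μ s := hlim.hasSubgaussianIncrements
    (fun j => hasSubgaussianIncrements_uniformMeasure_periodicBC (hne (k j))) hslopes
  exact ⟨μ, hμ, hlim.isShiftInvariant fun _ => isShiftInvariant_uniformMeasure_periodicBC,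
    hlim.isGradientGibbs fun _ hx => hk1.tendsto_atTop.eventually (eventually_notMem_latticeN hx),
    hlim.hasSlope (fun j => hasSlope_uniformMeasure_periodicBC (hne (k j))) hslopes,
    hsub.variance_le, fun x y _ _ ha => hsub.upper_tail_le x y ha,
    fun x y _ _ ha => hsub.lower_tail_le x y ha, approxSlope s, fun j => k j + 1,
    fun n _ => approxSlope_mem_slopesN hs n, tendsto_approxSlope s, hk1, fun j => (k j).succ_pos,
    hlim.locallyConverges⟩

theorem mainTheorem7 (d : ℕ) (hd : 2 ≤ d) (s : Module.Dual ℝ (H d)) (hs : s ∈ slopes d) :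
    ∃ μ : Measure (HeightFunction d),
      IsProbabilityMeasure μ ∧ IsShiftInvariant μ ∧ IsGradientGibbs μ ∧ HasSlope μ s ∧
      (∀ x y : X d,
        ProbabilityTheory.variance (fun f : HeightFunction d => (f y : ℝ) - (f x : ℝ)) μ
          ≤ ((d : ℝ) + 1) ^ 2 * ((graph d).dist x y : ℝ)) ∧
      (∀ x y : X d, 0 < (graph d).dist x y → ∀ a : ℝ, 0 ≤ a →
        μ.real {f | (f y : ℝ) - (f x : ℝ) - s (embed d (y - x)) ≥ ((d : ℝ) + 1) * a}
          ≤ Real.exp (-(a ^ 2 / (2 * ((graph d).dist x y : ℝ))))) ∧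
      (∀ x y : X d, 0 < (graph d).dist x y → ∀ a : ℝ, a ≤ 0 →
        μ.real {f | (f y : ℝ) - (f x : ℝ) - s (embed d (y - x)) ≤ ((d : ℝ) + 1) * a}
          ≤ Real.exp (-(a ^ 2 / (2 * ((graph d).dist x y : ℝ))))) ∧
      (∃ (t : ℕ → Module.Dual ℝ (H d)) (k : ℕ → ℕ),
        (∀ n, 0 < n → t n ∈ slopesN d n) ∧
        (∀ v : H d, Tendsto (fun n => t n v) atTop (𝓝 (s v))) ∧
        StrictMono k ∧ (∀ j, 0 < k j) ∧
        LocallyConverges (fun j => uniformMeasure (periodicBC (latticeN d (k j)) (t (k j)))) μ) :=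
  mainTheorem7_general d (by omega) s hs
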